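/- Let $E$ be a separable Fréchet space over $\mathbb C$, let $C\in L(E)$ be injective with dense range $R(C)$, let $A$ be a closed linear operator on $E$, and let $(S_0(t))_{t\ge 0}\subseteq L(E)$ be a global $C$-regularized semigroup with subgenerator $A$; that is, $t\mapsto S_0(t)x$ is continuous for every $x\in E$, $S_0(t)A\subseteq AS_0(t)$, $S_0(t)C=CS_0(t)$, and, for all $x\in E$ and $t\ge 0$, $\int_0^tS_0(s)x\,ds\in D(A)$ and $A\int_0^tS_0(s)x\,ds=S_0(t)x-Cx$. Let $Z_1(A)$ be the set of all $x\in E$ for which there is a unique continuous $u:[0,\infty)\to E$ with $\int_0^tu(s)\,ds\in D(A)$ and $A\int_0^tu(s)\,ds=u(t)-x$ for all $t\ge 0$. Set $T(t)x:=C^{-1}S_0(t)x$ for $t\ge 0$, $x\in Z_1(A)$. For an operator $B$ and a closed subspace $\tilde E$ of $E$, $B_{|\tilde E}:=\{(x,y)\in B: x,y\in\tilde E\}$ denotes the part of $B$ in $\tilde E$ (operators are identified with their graphs). Frequent hypercyclicity is understood as follows. A linear operator $B$ on a space $X$ is frequently hypercyclic if there is $x\in\bigcap_{n}D(B^n)$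 with $\liminf_{n\to\infty}\frac1n|\{k\in\{1,\dots,n\}:B^kx\in V\}|>0$ for every nonempty open $V\subseteq X$. A family $(B(t))_{t\ge0}$ of linear operators on $X$ is frequently hypercyclic if there is $x\in\bigcap_{t\ge0}D(B(t))$ with $\liminf_{t\to\infty}\frac1t\,m(\{s\in[0,t]:B(s)x\in V\})>0$ for every nonempty open $V\subseteq X$, where $m$ is Lebesgue measure. The $C$-regularized semigroup $(S_0(t))_{t\ge0}$ is frequently hypercyclic if the family $(T(t))_{t\ge0}$, with common domain $Z_1(A)$, is. Let $t_0>0$ and let $(f_j)_{j\in\Gamma}$ be a family of twice continuously differentiable mappings $f_j:I_j\to E$, where each $I_j\subseteq\mathbb R$ is a non-degenerate interval (one with more than one point), such that $f_j(t)\in D(A)$ and $Af_j(t)=itf_j(t)$ for all $t\in I_j$, $j\in\Gamma$. (i) If $\operatorname{span}\{f_j(t):j\in\Gamma,\ t\in I_j\}$ is dense in $E$, then $(S_0(t))_{t\ge0}$ is frequently hypercyclic and the operator $T(t_0)$ is frequently hypercyclic. (ii) Without this density assumption, set $\tilde E:=\overline{\operatorname{span}\{f_j(t):j\in\Gamma,\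 t\in I_j\}}$. Then the family $(T(t)_{|\tilde E})_{t\ge0}$ and the operator $T(t_0)_{|\tilde E}$ are frequently hypercyclic in $\tilde E$. If moreover $C(\tilde E)\subseteq\tilde E$, so that $C_{|\tilde E}\in L(\tilde E)$, then $S_0(t)(\tilde E)\subseteq\tilde E$ for all $t\ge0$, the operator $A_{|\tilde E}$ is a subgenerator of the global $C_{|\tilde E}$-regularized semigroup $(S_0(t)_{|\tilde E})_{t\ge0}$ on $\tilde E$, and $(S_0(t)_{|\tilde E})_{t\ge0}$ is frequently hypercyclic in $\tilde E$. -/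

import Mathlib

open Set Filter Topology
open scoped NNReal ENNReal

noncomputable section

section Densities

/-- Lower density `liminf |A ∩ [1,n]| / n` of a set of natural numbers. -/
def lowerDensityNat (A : Set ℕ) : ℝ≥0∞ :=
  liminf (fun n : ℕ => ((A ∩ Icc 1 n).ncard : ℝ≥0∞) / (n : ℝ≥0∞)) atTop

/-- Lower density `liminf m(A ∩ [0,t]) / t` (as `t → ∞`) of a subset of `[0,∞)`,
`m` being the Lebesgue measure. -/
def lowerDensityReal (A : Set ℝ≥0) : ℝ≥0∞ :=
  liminf (fun t : ℝ≥0 =>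
    MeasureTheory.volume ((fun s : ℝ≥0 => (s : ℝ)) '' (A ∩ Iic t)) / (t : ℝ≥0∞)) atTop

end Densities

section Hypercyclicity

/-- The `n`-th power of an operator given by its graph. -/
def opPow {X : Type*} (T : Set (X × X)) : ℕ → Set (X × X)
  | 0 => {p | p.1 = p.2}
  | n + 1 => {p | ∃ y, (p.1, y) ∈ opPow T n ∧ (y, p.2) ∈ T}

/-- A (possibly not everywhere defined) operator, given by its graph, is frequently hypercyclic:
some `x ∈ ⋂ₙ D(Tⁿ)` visits each nonempty open set with positive lower density. -/
def FrequentlyHypercyclicOp {X : Type*} [TopologicalSpace X] (T : Set (X × X)) : Prop :=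
  ∃ x : X, (∀ n, ∃ y, (x, y) ∈ opPow T n) ∧
    ∀ V : Set X, IsOpen V → V.Nonempty →
      0 < lowerDensityNat {n | ∃ y ∈ V, (x, y) ∈ opPow T n}

/-- The continuous-time analogue, for a family `(T(t))_{t ≥ 0}` of operators given by graphs. -/
def FrequentlyHypercyclicFamily {X : Type*} [TopologicalSpace X] (T : ℝ≥0 → Set (X × X)) :
    Prop :=
  ∃ x : X, (∀ t, ∃ y, (x, y) ∈ T t) ∧
    ∀ V : Set X, IsOpen V → V.Nonempty →
      0 < lowerDensityReal {t | ∃ y ∈ V, (x, y) ∈ T t}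

end Hypercyclicity

section Parts

variable {E : Type*} [AddCommGroup E] [Module ℂ E]

/-- The part in the subspace `F` of an operator given by its graph. -/
def graphPart (T : Set (E × E)) (F : Submodule ℂ E) : Set (F × F) :=
  {p | ((p.1 : E), (p.2 : E)) ∈ T}

/-- The part of the linear operator `A` in the subspace `F`. -/
def opPart (A : E →ₗ.[ℂ] E) (F : Submodule ℂ E) : F →ₗ.[ℂ] F :=
  (A.graph.comap (F.subtype.prodMap F.subtype)).toLinearPMap

theorem graph_opPart (A : E →ₗ.[ℂ] E) (F : Submodule ℂ E) :
    ((opPart A F).graph : Set (F × F)) = graphPart (A.graph : Set (E × E)) F := by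
  have h : (opPart A F).graph = A.graph.comap (F.subtype.prodMap F.subtype) := by
    apply Submodule.toLinearPMap_graph_eq
    rintro ⟨x, y⟩ hxy hx
    have hx' : (x : E) = 0 := by
      have : x = 0 := hx
      simp [this]
    have := A.graph_fst_eq_zero_snd (x := (x : E)) (x' := (y : E)) hxy hx'
    exact Subtype.ext this
  rw [h]
  rfl

end Parts

section Semigroups

variable {E : Type*} [AddCommGroup E] [Module ℂ E] [TopologicalSpace E]

/-- `y = ∫₀ᵗ u(s) ds`, in the weak sense. For continuous `u` with values in a Fréchet space such
a `y` exists, is unique, and is the limit of the Riemann sums; only continuous `u` occur below. -/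
def HasIntegral (u : ℝ≥0 → E) (t : ℝ≥0) (y : E) : Prop :=
  ∀ φ : E →L[ℂ] ℂ, φ y = ∫ s in (0 : ℝ)..t, φ (u s.toNNReal)

/-- `A` is a subgenerator of the global `C`-regularized semigroup `(S(t))_{t ≥ 0}`. -/
structure IsSubgenerator (A : E →ₗ.[ℂ] E) (C : E →L[ℂ] E) (S : ℝ≥0 → E →L[ℂ] E) : Prop where
  isClosed : A.IsClosed
  injective : Function.Injective C
  continuous : ∀ x, Continuous fun t => S t x
  comm_generator : ∀ t x y, (x, y) ∈ A.graph → (S t x, S t y) ∈ A.graph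
  comm_regularizer : ∀ t x, S t (C x) = C (S t x)
  integral_mem : ∀ x t, ∃ y, HasIntegral (fun s => S s x) t y ∧ (y, S t x - C x) ∈ A.graph

/-- `u` is a mild solution of `u' = A u`, `u(0) = x`, on `[0,∞)`. -/
def IsMildSolution (A : E →ₗ.[ℂ] E) (x : E) (u : ℝ≥0 → E) : Prop :=
  Continuous u ∧ ∀ t, ∃ y, HasIntegral u t y ∧ (y, u t - x) ∈ A.graph

/-- The solution space `Z₁(A)`: those initial values which have a unique mild solution. -/
def solutionSpace (A : E →ₗ.[ℂ] E) : Set E :=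
  {x | ∃! u : ℝ≥0 → E, IsMildSolution A x u}

/-- The graph of `T(t) = C⁻¹ S(t)` with domain `Z₁(A)` (`C` is injective in all applications). -/
def regularizedOp (A : E →ₗ.[ℂ] E) (C : E →L[ℂ] E) (S : ℝ≥0 → E →L[ℂ] E) (t : ℝ≥0) :
    Set (E × E) :=
  {p | p.1 ∈ solutionSpace A ∧ C p.2 = S t p.1}

/-- A `C`-regularized semigroup is frequently hypercyclic if the family `T(t) = C⁻¹ S(t)`,
`t ≥ 0`, on `Z₁(A)` is. -/
def FrequentlyHypercyclicSemigroup (A : E →ₗ.[ℂ] E) (C : E →L[ℂ] E) (S : ℝ≥0 → E →L[ℂ] E) :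
    Prop :=
  FrequentlyHypercyclicFamily (regularizedOp A C S)

/-- `f` is twice continuously differentiable on `I` (one-sided derivatives at the endpoints
that belong to `I`). -/
def IsC2On (f : ℝ → E) (I : Set ℝ) : Prop :=
  ∃ f' f'' : ℝ → E,
    (∀ t ∈ I, Tendsto (fun s : ℝ => ((s - t : ℝ) : ℂ)⁻¹ • (f s - f t)) (𝓝[I \ {t}] t)
      (𝓝 (f' t))) ∧
    (∀ t ∈ I, Tendsto (fun s : ℝ => ((s - t : ℝ) : ℂ)⁻¹ • (f' s - f' t)) (𝓝[I \ {t}] t)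
      (𝓝 (f'' t))) ∧
    ContinuousOn f'' I

/-- The linear span of the values `f_j(t)`, `t ∈ I_j`. -/
def fieldSpan {Γ : Type*} (I : Γ → Set ℝ) (f : Γ → ℝ → E) : Submodule ℂ E :=
  Submodule.span ℂ {x | ∃ j, ∃ t ∈ I j, f j t = x}

end Semigroups

end

/-! The theorem follows from one explicitly built solution `u : ℝ → E` of the integrated equation
`u' = A u`, with values in the closed span `G` of the eigenvector fields, whose orbit visits every
open set meeting `G` with positive lower density.

Building blocks. For `[a, b] ⊆ I_j` and `w(s) = (s - a)² (b - s)²`, the wave packet `y(t) = ∫ₐᵇ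
e^{its} w(s) f_j(s) ds` solves the equation on all of `ℝ`, because `A f_j(s) = i s f_j(s)`. Since
`w` vanishes to second order at both endpoints and `f_j` is C², two integrations by parts give decay
`O(1 / (1 + t²))` in every seminorm (`exists_isDecayingSolution`). The values at time zero of such
solutions are dense in `G`: a functional killing all of them kills every `f_j(s)`, as is seen by
shrinking `[a, b]` (`fieldSpan_le_closure_initialValues`).

Superposition. Take a sequence `y_k` of decaying solutions that repeats each member of a countable
dense family infinitely often, and put `u(t) = ∑_{k,j} y_k(t - n(k,j) t₀)`. The integers `n(k,j)`
grow linearly in `j` for each `k`, yet are so far apart that near time `n(k,j) t₀` all the other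
terms add up to at most `2 · 2⁻ᵏ` in the first seminorms (`exists_separated_positions`,
`exists_superposition`). Thus `u` follows `y_k` there, at times of positive lower density, both
along multiples of `t₀` and in continuous time.

Return to the semigroup. Mild solutions are unique, so each `u(c)` lies in `Z₁(A)`, and `C u(c + t)
= S(t) u(c)`, that is, `T(t) u(c) = u(c + t)`. The orbit of `u(0)` is therefore `u` itself.
Restriction to `G` keeps all of this, and `S(t) f_j(s) = e^{its} C f_j(s)` shows that `G` is
invariant under `S(t)` once it is invariant under `C`.

Integrals are weak throughout. Membership in the closed graph of `A` is tested on pairs of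
functionals annihilating it, and seminorm bounds are recovered from the functionals that the
seminorm dominates. -/

/-! ### Consequences of the Hahn–Banach theorem. -/

section HahnBanach

variable {E : Type*} [AddCommGroup E] [Module ℂ E] [TopologicalSpace E] [IsTopologicalAddGroup E]
  [ContinuousSMul ℂ E]

/-- A point on which every functional annihilating a closed subspace vanishes lies in it. -/
theorem Submodule.mem_of_forall_annihilator [LocallyConvexSpace ℝ E] {G : Submodule ℂ E}
    (hG : IsClosed (G : Set E)) {x : E}
    (h : ∀ φ : E →L[ℂ] ℂ, (∀ y ∈ G, φ y = 0) → φ x = 0) : x ∈ G := by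
  by_contra hx
  obtain ⟨φ, u, hφ, hu⟩ := RCLike.geometric_hahn_banach_closed_point (𝕜 := ℂ)
    (s := (G : Set E)) (G.restrictScalars ℝ).convex hG hx
  have h0 : 0 < u := by simpa using hφ 0 G.zero_mem
  have hz : ∀ y ∈ G, φ y = 0 := by
    intro y hy
    by_contra hne
    have hpos : 0 < Complex.normSq (φ y) := Complex.normSq_pos.2 hne
    -- This multiple of `y` is scaled to have `φ`-value exactly `u`, against the strict bound on
    -- `G`.
    have := hφ (((u / Complex.normSq (φ y) : ℝ) : ℂ) • (starRingEnd ℂ (φ y)) • y)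
      (G.smul_mem _ (G.smul_mem _ hy))
    have he : φ (((u / Complex.normSq (φ y) : ℝ) : ℂ) • (starRingEnd ℂ (φ y)) • y) = (u : ℂ) := by
      rw [φ.map_smul, φ.map_smul, smul_eq_mul, smul_eq_mul, ← Complex.normSq_eq_conj_mul_self,
        ← Complex.ofReal_mul, div_mul_cancel₀ _ hpos.ne']
    rw [he] at this
    simp at this
  have := h φ hz
  rw [this] at hu
  simp at hu
  linarith

theorem eq_of_forall_dual_eq [LocallyConvexSpace ℝ E] [T2Space E] {x y : E}
    (h : ∀ φ : E →L[ℂ] ℂ, φ x = φ y) : x = y := by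
  have : x - y ∈ (⊥ : Submodule ℂ E) := by
    refine Submodule.mem_of_forall_annihilator (by simp) fun φ _ => ?_
    rw [map_sub, h φ, sub_self]
  exact sub_eq_zero.1 (by simpa using this)

omit [IsTopologicalAddGroup E] [ContinuousSMul ℂ E] in
/-- A continuous seminorm is controlled by the functionals it dominates. -/
theorem Seminorm.le_of_forall_dual [PolynormableSpace ℂ E] {q : Seminorm ℂ E}
    (hq : Continuous q) {x : E} {r : ℝ} (h : ∀ φ : E →L[ℂ] ℂ, (∀ y, ‖φ y‖ ≤ q y) → ‖φ x‖ ≤ r) :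
    q x ≤ r := by
  rcases eq_or_ne x 0 with rfl | hx
  · simpa using h 0 (by simp)
  let e := LinearEquiv.coord ℂ E x hx
  -- Extend `c • x ↦ c * q x` from the line through `x`; the extension is dominated by `q` and
  -- equals `q x` at `x`.
  obtain ⟨φ, hφ, hle⟩ := Module.Dual.exists_continuous_extension_of_le_seminorm
    (Submodule.span ℂ {x}) ((q x : ℂ) • e.toLinearMap) hq (by
      intro y
      have hy : e y • x = (y : E) := LinearEquiv.coord_apply_smul ℂ E x hx y
      conv_rhs => rw [← hy, map_smul_eq_mul]
      simp [abs_of_nonneg, mul_comm])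
  have h1 := h φ hle
  have h2 : φ x = q x := by
    have := hφ ⟨x, Submodule.mem_span_singleton_self x⟩
    have h3 : e ⟨x, Submodule.mem_span_singleton_self x⟩ = 1 := LinearEquiv.coord_self ℂ E x hx
    simpa [h3] using this
  rw [h2] at h1
  simpa [abs_of_nonneg] using h1

omit [IsTopologicalAddGroup E] [ContinuousSMul ℂ E] in
theorem PolynormableSpace.exists_seminorm_ball_subset [PolynormableSpace ℂ E] {U : Set E}
    (hU : U ∈ 𝓝 (0 : E)) : ∃ q : Seminorm ℂ E, Continuous q ∧ ∃ r > 0, q.ball 0 r ⊆ U := by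
  have hp := PolynormableSpace.withSeminorms ℂ E
  obtain ⟨s, r, hr, hs⟩ := (hp.mem_nhds_iff 0 U).1 hU
  refine ⟨_, ?_, r, hr, hs⟩
  refine Finset.sup_induction (p := fun q : Seminorm ℂ E => Continuous q) continuous_zero
    (fun q₁ h₁ q₂ h₂ => ?_) fun i _ => i.2
  rw [Seminorm.coe_sup]
  exact h₁.sup h₂

end HahnBanach

/-! ### Weak integrals of continuous curves. -/

section WeakIntegral

variable {E : Type*} [AddCommGroup E] [Module ℂ E] [UniformSpace E] [IsUniformAddGroup E]
  [ContinuousSMul ℂ E]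

omit [ContinuousSMul ℂ E] in
theorem cauchySeq_of_seminorm [PolynormableSpace ℂ E] {x : ℕ → E}
    (h : ∀ q : Seminorm ℂ E, Continuous q → ∀ ε > 0, ∃ N, ∀ m ≥ N, ∀ n ≥ N,
      q (x m - x n) < ε) : CauchySeq x := by
  rw [cauchySeq_iff]
  intro V hV
  rw [uniformity_eq_comap_nhds_zero, Filter.mem_comap] at hV
  obtain ⟨U, hU, hUV⟩ := hV
  obtain ⟨q, hq, r, hr, hqU⟩ := PolynormableSpace.exists_seminorm_ball_subset hU
  obtain ⟨N, hN⟩ := h q hq r hr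
  refine ⟨N, fun m hm n hn => hUV (hqU ?_)⟩
  rw [Seminorm.mem_ball_zero]
  exact hN n hn m hm

theorem riemannSum_sub_integral_le {g : ℝ → ℂ} (hg : Continuous g) {a h ε : ℝ} (hh : 0 ≤ h)
    (n : ℕ) (hε : ∀ k < n, ∀ s ∈ Icc (a + k * h) (a + (k + 1) * h), ‖g s - g (a + k * h)‖ ≤ ε) :
    ‖(h : ℂ) * ∑ k ∈ Finset.range n, g (a + k * h) - ∫ s in a..(a + n * h), g s‖
      ≤ ε * (n * h) := by
  have hint : ∑ k ∈ Finset.range n, ∫ s in (a + k * h)..(a + (k + 1 : ℕ) * h), g s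
      = ∫ s in a..(a + n * h), g s := by
    have := intervalIntegral.sum_integral_adjacent_intervals (μ := MeasureTheory.volume) (f := g)
      (a := fun k : ℕ => a + k * h) (n := n) (fun k _ => hg.intervalIntegrable _ _)
    simpa using this
  rw [← hint, Finset.mul_sum, ← Finset.sum_sub_distrib]
  calc _ ≤ ∑ k ∈ Finset.range n, ε * h := by
        refine norm_sum_le_of_le _ fun k hk => ?_
        have h1 : (h : ℂ) * g (a + k * h)
            = ∫ s in (a + k * h)..(a + (k + 1 : ℕ) * h), g (a + k * h) := by
          rw [intervalIntegral.integral_const, Complex.real_smul]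
          congr 2
          push_cast; ring
        rw [h1, ← intervalIntegral.integral_sub (by simp) (hg.intervalIntegrable _ _)]
        have hle : a + k * h ≤ a + (k + 1 : ℕ) * h := by push_cast; nlinarith
        refine (intervalIntegral.norm_integral_le_of_norm_le_const (C := ε) ?_).trans_eq ?_
        · intro s hs
          rw [uIoc_of_le hle] at hs
          rw [norm_sub_rev]
          refine hε k (Finset.mem_range.1 hk) s ⟨hs.1.le, ?_⟩
          simpa using hs.2
        · rw [abs_of_nonneg (by linarith)]; push_cast; ring
    _ = _ := by simp; ring

omit [ContinuousSMul ℂ E] in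
/-- Existence of the weak integral of a continuous curve in a complete locally convex space. -/
theorem exists_weakIntegral [PolynormableSpace ℂ E] [CompleteSpace E] {u : ℝ → E}
    (hu : Continuous u) {a b : ℝ} (hab : a ≤ b) :
    ∃ y, ∀ φ : E →L[ℂ] ℂ, φ y = ∫ s in a..b, φ (u s) := by
  let h : ℕ → ℝ := fun n => (b - a) / (n + 1)
  have hh : ∀ n, 0 ≤ h n := fun n => div_nonneg (by linarith) (by positivity)
  have hnh : ∀ n : ℕ, a + (n + 1 : ℕ) * h n = b := by
    intro n; simp only [h]; push_cast; field_simp; ring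
  let x : ℕ → E := fun n => (h n : ℂ) • ∑ k ∈ Finset.range (n + 1), u (a + k * h n)
  -- The rate is uniform over all `φ` dominated by `q`; this makes the Riemann sums Cauchy for `q`.
  have key : ∀ q : Seminorm ℂ E, Continuous q → ∀ ε > 0, ∃ N, ∀ n ≥ N, ∀ φ : E →L[ℂ] ℂ,
      (∀ y, ‖φ y‖ ≤ q y) → ‖φ (x n) - ∫ s in a..b, φ (u s)‖ ≤ ε := by
    intro q hq ε hε
    have huc := isCompact_Icc (a := a) (b := b) |>.uniformContinuousOn_of_continuous hu.continuousOn
    -- The summand 1 keeps the denominator positive when `a = b`.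
    have hε' : 0 < ε / (b - a + 1) := div_pos hε (by linarith)
    have hV : {z : E × E | q (z.2 - z.1) < ε / (b - a + 1)} ∈ uniformity E := by
      rw [uniformity_eq_comap_nhds_zero, Filter.mem_comap]
      exact ⟨q.ball 0 _, q.ball_mem_nhds hq hε', fun z hz => by simpa using hz⟩
    have := huc hV
    rw [Filter.mem_map, Filter.mem_inf_principal, Metric.mem_uniformity_dist] at this
    obtain ⟨δ, hδ, hδ'⟩ := this
    obtain ⟨N, hN⟩ := exists_nat_gt ((b - a) / δ)
    refine ⟨N, fun n hn φ hφ => ?_⟩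
    have hnδ : h n < δ := by
      have : (b - a) / δ < n + 1 := hN.trans (by exact_mod_cast Nat.lt_succ_of_le hn)
      rw [div_lt_iff₀ hδ] at this
      simp only [h]
      rw [div_lt_iff₀ (by positivity)]
      linarith
    have h2 := riemannSum_sub_integral_le (g := fun s => φ (u s)) (φ.continuous.comp hu) (a := a)
      (ε := ε / (b - a + 1)) (hh n) (n + 1) (by
        intro k hk s hs
        rw [← map_sub]
        refine (hφ _).trans (le_of_lt ?_)
        have hk0 : (0 : ℝ) ≤ k * h n := mul_nonneg (by positivity) (hh n)
        have hk1 : a + (k + 1) * h n ≤ b := by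
          rw [← hnh n]
          have : ((k + 1 : ℕ) : ℝ) ≤ (n + 1 : ℕ) := by exact_mod_cast hk
          push_cast at this ⊢
          nlinarith [hh n]
        have hkk : a + k * h n ≤ a + (k + 1) * h n := by nlinarith [hh n]
        refine hδ' (a := a + k * h n) (b := s) ?_ ⟨⟨by linarith, by linarith⟩,
          ⟨by linarith [hs.1], by linarith [hs.2]⟩⟩
        rw [Real.dist_eq, abs_lt]
        constructor <;> nlinarith [hs.1, hs.2])
    rw [hnh n] at h2
    have h3 : φ (x n) = (h n : ℂ) * ∑ k ∈ Finset.range (n + 1), φ (u (a + k * h n)) := by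
      simp [x]
    rw [h3]
    refine h2.trans ?_
    have : ((n + 1 : ℕ) : ℝ) * h n = b - a := by linarith [hnh n]
    rw [this, div_mul_eq_mul_div, div_le_iff₀ (by linarith)]
    nlinarith
  have hc : CauchySeq x := by
    refine cauchySeq_of_seminorm fun q hq ε hε => ?_
    obtain ⟨N, hN⟩ := key q hq (ε / 3) (by positivity)
    refine ⟨N, fun m hm n hn => ?_⟩
    refine lt_of_le_of_lt (b := ε / 3 + ε / 3) (q.le_of_forall_dual hq fun φ hφ => ?_) (by linarith)
    have : φ (x m - x n) = (φ (x m) - ∫ s in a..b, φ (u s)) - (φ (x n) - ∫ s in a..b, φ (u s)) := by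
      rw [map_sub]; ring
    rw [this]
    exact (norm_sub_le _ _).trans (add_le_add (hN m hm φ hφ) (hN n hn φ hφ))
  obtain ⟨y, hy⟩ := cauchySeq_tendsto_of_complete hc
  refine ⟨y, fun φ => ?_⟩
  refine tendsto_nhds_unique ((φ.continuous.tendsto y).comp hy) ?_
  rw [Metric.tendsto_atTop]
  intro ε hε
  obtain ⟨N, hN⟩ := key φ.toSeminorm φ.continuous.norm (ε / 2) (by positivity)
  refine ⟨N, fun n hn => ?_⟩
  rw [dist_eq_norm]
  exact (hN n hn φ fun y => le_rfl).trans_lt (by linarith)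

end WeakIntegral

/-! ### Uniqueness of mild solutions for a subgenerator. -/

section Uniqueness

theorem intervalIntegral_triangle_swap {G : ℝ → ℝ → ℂ} (hG : Continuous G.uncurry) {T : ℝ}
    (hT : 0 ≤ T) :
    ∫ r in (0 : ℝ)..T, ∫ s in (0 : ℝ)..(T - r), G r s
      = ∫ s in (0 : ℝ)..T, ∫ r in (0 : ℝ)..(T - s), G r s := by
  have key : ∀ H : ℝ → ℂ, Continuous H → ∀ r ∈ uIcc 0 T, ∫ s in (0 : ℝ)..(T - r), H s
      = ∫ s in (0 : ℝ)..T, {s | r + s ≤ T}.indicator H s := by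
    intro H hH r hr
    rw [uIcc_of_le hT] at hr
    have hset : {s : ℝ | r + s ≤ T} = Iic (T - r) := by ext s; simp [le_sub_iff_add_le']
    have hmem : T - r ∈ Icc 0 T := ⟨by linarith [hr.2], by linarith [hr.1]⟩
    rw [hset]
    exact (intervalIntegral.integral_indicator hmem).symm
  have hm : MeasurableSet {z : ℝ × ℝ | z.1 + z.2 ≤ T} :=
    (isClosed_le (by fun_prop) (by fun_prop)).measurableSet
  rw [intervalIntegral.integral_congr (g := fun r => ∫ s in (0 : ℝ)..T,
      {z : ℝ × ℝ | z.1 + z.2 ≤ T}.indicator G.uncurry (r, s))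
      fun r hr => key (G r) (hG.comp (f := fun s => (r, s)) (by fun_prop)) r hr,
    MeasureTheory.intervalIntegral_intervalIntegral_swap (F := fun r s =>
      {z : ℝ × ℝ | z.1 + z.2 ≤ T}.indicator G.uncurry (r, s))]
  · refine intervalIntegral.integral_congr fun s hs => ?_
    refine (intervalIntegral.integral_congr fun r _ => ?_).trans
      (key (fun r => G r s) (hG.comp (f := fun r => (r, s)) (by fun_prop)) s hs).symm
    simp only [indicator, mem_ofPred_eq, add_comm, Function.uncurry]
  · refine MeasureTheory.IntegrableOn.indicator ?_ hm
    exact (hG.continuousOn.integrableOn_compact (isCompact_uIcc.prod isCompact_uIcc)).mono_set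
      (prod_mono uIoc_subset_uIcc uIoc_subset_uIcc)

theorem eq_zero_of_forall_integral_eq_zero {g : ℝ → ℂ} (hg : Continuous g)
    (h : ∀ T : ℝ, 0 ≤ T → ∫ s in (0 : ℝ)..T, g s = 0) {T : ℝ} (hT : 0 ≤ T) : g T = 0 := by
  have h1 : HasDerivWithinAt (fun t => ∫ s in (0 : ℝ)..t, g s) (g T) (Ici T) T :=
    (hg.integral_hasStrictDerivAt 0 T).hasDerivAt.hasDerivWithinAt
  have h2 : HasDerivWithinAt (fun t => ∫ s in (0 : ℝ)..t, g s) 0 (Ici T) T :=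
    (hasDerivWithinAt_const T (Ici T) (0 : ℂ)).congr_of_mem
      (fun t ht => h t (hT.trans ht)) self_mem_Ici
  exact (uniqueDiffWithinAt_Ici T).eq_deriv _ h1 h2

variable {E : Type*} [AddCommGroup E] [Module ℂ E]

/-- A functional on `E × E` is a pair `(φ, ψ)`. This criterion lets closed operators pass through
weak integrals by scalar computations. -/
theorem LinearPMap.mem_graph_of_forall_annihilator [TopologicalSpace E] [IsTopologicalAddGroup E]
    [ContinuousSMul ℂ E] [LocallyConvexSpace ℝ E] {A : E →ₗ.[ℂ] E} (hA : A.IsClosed) {x y : E}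
    (h : ∀ φ ψ : E →L[ℂ] ℂ, (∀ a b, (a, b) ∈ A.graph → φ a + ψ b = 0) → φ x + ψ y = 0) :
    (x, y) ∈ A.graph := by
  refine Submodule.mem_of_forall_annihilator (E := E × E) hA fun Φ hΦ => ?_
  have hs : ∀ a b, Φ (a, b) = Φ.comp (.inl ℂ E E) a + Φ.comp (.inr ℂ E E) b := by
    intro a b
    rw [Φ.comp_apply, Φ.comp_apply, ← Φ.map_add]
    simp
  rw [hs]
  exact h _ _ fun a b hab => by rw [← hs]; exact hΦ _ hab

variable [UniformSpace E] [IsUniformAddGroup E] [ContinuousSMul ℂ E]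

omit [IsUniformAddGroup E] [ContinuousSMul ℂ E] in
theorem HasIntegral.sub {u v : ℝ≥0 → E} (hu : Continuous u) (hv : Continuous v) {t : ℝ≥0}
    {y z : E} (hy : HasIntegral u t y) (hz : HasIntegral v t z) :
    HasIntegral (fun s => u s - v s) t (y - z) := by
  intro φ
  simp only [map_sub]
  rw [hy φ, hz φ, intervalIntegral.integral_sub]
  · exact (φ.continuous.comp (hu.comp continuous_real_toNNReal)).intervalIntegrable _ _
  · exact (φ.continuous.comp (hv.comp continuous_real_toNNReal)).intervalIntegrable _ _

omit [IsUniformAddGroup E] [ContinuousSMul ℂ E] in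
theorem HasIntegral.map {u : ℝ≥0 → E} {t : ℝ≥0} {y : E} (hy : HasIntegral u t y) (L : E →L[ℂ] E) :
    HasIntegral (fun s => L (u s)) t (L y) :=
  fun φ => hy (φ.comp L)

/-- Strong continuity of a family of operators on a barrelled space is joint continuity. -/
theorem continuous_uncurry_of_strongly_continuous [PolynormableSpace ℂ E] [BarrelledSpace ℂ E]
    {S : ℝ≥0 → E →L[ℂ] E} (hS : ∀ x, Continuous fun t => S t x) :
    Continuous fun z : ℝ≥0 × E => S z.1 z.2 := by
  rw [continuous_iff_continuousAt]
  rintro ⟨r, x⟩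
  -- Orbits are bounded on `[0, r + 1]`, so Banach–Steinhaus gives equicontinuity there. It handles
  -- `S(z.1)(z.2 - x)`, and strong continuity handles `S(z.1) x`.
  have heq : UniformEquicontinuous ((↑) ∘ fun i : Icc 0 (r + 1) => S i) := by
    refine (PolynormableSpace.withSeminorms ℂ E).banach_steinhaus fun q y => ?_
    have := isCompact_Icc (a := 0) (b := r + 1) |>.bddAbove_image
      (f := fun t => q.1 (S t y)) (q.2.comp (hS y)).continuousOn
    rwa [image_eq_range] at this
  have h0 := heq.equicontinuous 0
  have h1 : Tendsto (fun z : ℝ≥0 × E => S z.1 (z.2 - x)) (𝓝 (r, x)) (𝓝 0) := by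
    intro U hU
    have hV : {w : E × E | w.2 - w.1 ∈ U} ∈ uniformity E := by
      rw [uniformity_eq_comap_nhds_zero]
      exact Filter.preimage_mem_comap hU
    have h2 := h0 _ hV
    have h3 : Tendsto (fun z : ℝ≥0 × E => z.2 - x) (𝓝 (r, x)) (𝓝 0) := by
      have : Continuous fun z : ℝ≥0 × E => z.2 - x := by fun_prop
      simpa using this.tendsto (r, x)
    have h4 : ∀ᶠ z : ℝ≥0 × E in 𝓝 (r, x), z.1 < r + 1 :=
      continuous_fst.continuousAt.eventually_lt continuousAt_const (by simp)
    rw [Filter.mem_map]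
    filter_upwards [h3.eventually h2, h4] with z hz hz'
    simpa using hz ⟨z.1, bot_le, hz'.le⟩
  have h2 : Tendsto (fun z : ℝ≥0 × E => S z.1 x) (𝓝 (r, x)) (𝓝 (S r x)) :=
    ((hS x).comp continuous_fst).tendsto (r, x)
  simpa [ContinuousAt] using h1.add h2

variable {A : E →ₗ.[ℂ] E} {C : E →L[ℂ] E} {S : ℝ≥0 → E →L[ℂ] E}

namespace IsSubgenerator

theorem apply_zero [LocallyConvexSpace ℝ E] [T2Space E] (hA : IsSubgenerator A C S) (x : E) :
    S 0 x = C x := by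
  obtain ⟨y, hy, hy'⟩ := hA.integral_mem x 0
  have : y = 0 := eq_of_forall_dual_eq fun φ => by simpa using hy φ
  subst this
  exact sub_eq_zero.1 (A.graph_fst_eq_zero_snd hy' rfl)

/-- As `A` is closed, it maps `∫ S(s)x` to `∫ S(s)y`; the former is also sent to `S(t)x - Cx`, and
`A` is single-valued. -/
theorem sub_eq_integral [LocallyConvexSpace ℝ E] (hA : IsSubgenerator A C S) {x y : E}
    (hxy : (x, y) ∈ A.graph) (t : ℝ≥0) : HasIntegral (fun s => S s y) t (S t x - C x) := by
  obtain ⟨x', hx', hx''⟩ := hA.integral_mem x t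
  obtain ⟨y', hy', -⟩ := hA.integral_mem y t
  have hmem : (x', y') ∈ A.graph := by
    refine LinearPMap.mem_graph_of_forall_annihilator hA.isClosed fun φ ψ h => ?_
    rw [hx' φ, hy' ψ, ← intervalIntegral.integral_add]
    · simp [h _ _ (hA.comm_generator _ x y hxy)]
    · exact (φ.continuous.comp ((hA.continuous x).comp
        continuous_real_toNNReal)).intervalIntegrable _ _
    · exact (ψ.continuous.comp ((hA.continuous y).comp
        continuous_real_toNNReal)).intervalIntegrable _ _
  rw [A.mem_graph_snd_inj hx'' hmem rfl]
  exact hy'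

theorem comm_regularizer_graph [LocallyConvexSpace ℝ E] [T2Space E] (hA : IsSubgenerator A C S)
    {x y : E} (hxy : (x, y) ∈ A.graph) : (C x, C y) ∈ A.graph := by
  simpa only [hA.apply_zero] using hA.comm_generator 0 x y hxy

/-- Let `v(s) = ∫₀ˢ w`, so that `A v = w`. Then `C v(s)` equals `S(T - s) v(s) = ∫₀ˢ S(T - s) w(s')
ds'` minus `∫₀^{T-s} S(r) w(s) dr`. Integrated over `s ∈ [0, T]`, both terms become the integral of
`S(r) w(s)` over the triangle `r + s ≤ T` and cancel. Hence `∫₀ᵀ C v = 0` for all `T`, so `C v = 0`,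
`v = 0` and `w = A v = 0`. -/
theorem mildSolution_zero [LocallyConvexSpace ℝ E] [T2Space E]
    [PolynormableSpace ℂ E] [BarrelledSpace ℂ E]
    (hA : IsSubgenerator A C S) {w : ℝ≥0 → E} (hw : IsMildSolution A 0 w) (t : ℝ≥0) : w t = 0 := by
  obtain ⟨hwc, hw⟩ := hw
  choose v hv hvw using hw
  simp only [sub_zero] at hvw
  suffices h : C (v t) = 0 by
    have : v t = 0 := hA.injective (by simpa using h)
    have h2 := hvw t
    rw [this] at h2
    exact A.graph_fst_eq_zero_snd h2 rfl
  refine eq_of_forall_dual_eq fun φ => ?_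
  have hvφ : ∀ ψ : E →L[ℂ] ℂ, ∀ s : ℝ, 0 ≤ s →
      ψ (v s.toNNReal) = ∫ r in (0 : ℝ)..s, ψ (w r.toNNReal) := by
    intro ψ s hs
    rw [hv s.toNNReal ψ, Real.coe_toNNReal s hs]
  let G : ℝ → ℝ → ℂ := fun r s => φ (S r.toNNReal (w s.toNNReal))
  have hS := continuous_uncurry_of_strongly_continuous hA.continuous
  have hG : Continuous G.uncurry := by
    refine φ.continuous.comp (hS.comp (f := fun z : ℝ × ℝ => (z.1.toNNReal, w z.2.toNNReal)) ?_)
    fun_prop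
  let g : ℝ → ℂ := fun s => ∫ r in (0 : ℝ)..s, φ (C (w r.toNNReal))
  have hgc : Continuous g := by
    have : Continuous fun r : ℝ => φ (C (w r.toNNReal)) := by fun_prop
    exact intervalIntegral.continuous_primitive (fun a b => this.intervalIntegrable _ _) 0
  have hgv : ∀ s, 0 ≤ s → φ (C (v s.toNNReal)) = g s := fun s hs => hvφ (φ.comp C) s hs
  rw [map_zero, ← Real.toNNReal_coe (r := t)]
  refine (hgv _ t.2).trans ?_
  refine eq_zero_of_forall_integral_eq_zero hgc (fun T hT => ?_) t.2
  have hcG1 : Continuous fun s => ∫ r in (0 : ℝ)..(T - s), G r s :=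
    intervalIntegral.continuous_parametric_intervalIntegral_of_continuous
      (f := fun s r => G r s) (hG.comp continuous_swap) (by fun_prop)
  have hcG2 : Continuous fun r => ∫ s in (0 : ℝ)..(T - r), G r s :=
    intervalIntegral.continuous_parametric_intervalIntegral_of_continuous
        (f := fun r s => G r s) hG (by fun_prop)
  have hg : ∀ s ∈ uIcc 0 T, g s = (∫ s' in (0 : ℝ)..(T - (T - s)), G (T - s) s')
      - ∫ r in (0 : ℝ)..(T - s), G r s := by
    intro s hs
    rw [uIcc_of_le hT] at hs
    have h1 := hA.sub_eq_integral (hvw s.toNNReal) (T - s).toNNReal φ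
    rw [Real.coe_toNNReal _ (by linarith [hs.2])] at h1
    have h2 := hvφ (φ.comp (S (T - s).toNNReal)) s hs.1
    simp only [ContinuousLinearMap.comp_apply] at h2
    rw [map_sub, h2, hgv s hs.1] at h1
    rw [sub_sub_cancel]
    linear_combination -h1
  have hi : IntervalIntegrable (fun s => ∫ s' in (0 : ℝ)..(T - (T - s)), G (T - s) s')
      MeasureTheory.volume 0 T :=
    (hcG2.comp (f := fun s => T - s) (by fun_prop)).intervalIntegrable _ _
  rw [intervalIntegral.integral_congr hg, intervalIntegral.integral_sub hi
    (hcG1.intervalIntegrable _ _),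
    intervalIntegral.integral_comp_sub_left (fun r => ∫ s in (0 : ℝ)..(T - r), G r s) T,
    sub_self, sub_zero, intervalIntegral_triangle_swap hG hT, sub_self]

theorem mildSolution_unique [LocallyConvexSpace ℝ E] [T2Space E]
    [PolynormableSpace ℂ E] [BarrelledSpace ℂ E]
    (hA : IsSubgenerator A C S) {x : E} {u v : ℝ≥0 → E} (hu : IsMildSolution A x u)
    (hv : IsMildSolution A x v) : u = v := by
  have : IsMildSolution A 0 fun t => u t - v t := by
    refine ⟨hu.1.sub hv.1, fun t => ?_⟩
    obtain ⟨y, hy, hy'⟩ := hu.2 t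
    obtain ⟨z, hz, hz'⟩ := hv.2 t
    refine ⟨y - z, hy.sub hu.1 hv.1 hz, ?_⟩
    simpa using A.graph.sub_mem hy' hz'
  funext t
  exact sub_eq_zero.1 (hA.mildSolution_zero this t)

theorem mem_solutionSpace [LocallyConvexSpace ℝ E] [T2Space E]
    [PolynormableSpace ℂ E] [BarrelledSpace ℂ E]
    (hA : IsSubgenerator A C S) {x : E} {u : ℝ≥0 → E} (hu : IsMildSolution A x u) :
    x ∈ solutionSpace A :=
  ⟨u, hu, fun _ hv => hA.mildSolution_unique hv hu⟩

/-- Both sides are mild solutions with initial value `C x`. -/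
theorem regularizer_mildSolution [LocallyConvexSpace ℝ E] [T2Space E]
    [PolynormableSpace ℂ E] [BarrelledSpace ℂ E]
    (hA : IsSubgenerator A C S) {x : E} {u : ℝ≥0 → E} (hu : IsMildSolution A x u) (t : ℝ≥0) :
    C (u t) = S t x := by
  have h1 : IsMildSolution A (C x) fun t => C (u t) := by
    refine ⟨C.continuous.comp hu.1, fun t => ?_⟩
    obtain ⟨y, hy, hy'⟩ := hu.2 t
    refine ⟨C y, hy.map C, ?_⟩
    rw [← map_sub]
    exact hA.comm_regularizer_graph hy'
  have h2 : IsMildSolution A (C x) fun t => S t x := ⟨hA.continuous x, hA.integral_mem x⟩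
  exact congrFun (hA.mildSolution_unique h1 h2) t

end IsSubgenerator

end Uniqueness

/-! ### Separated integer positions of positive lower density. -/

section Positions

/-- Infinitely many infinite families of integers of linear growth, any two distinct members of
which, taken from the `k`-th and the `l`-th family, are at distance at least `N k + N l`. -/
theorem exists_separated_positions (N : ℕ → ℕ) : ∃ (n : ℕ → ℕ → ℕ) (L : ℕ → ℕ),
    (∀ k j, N k ≤ n k j) ∧
    (∀ k j l i, (k, j) ≠ (l, i) → n k j + (N k + N l) ≤ n l i ∨ n l i + (N k + N l) ≤ n k j) ∧
    (∀ k j, n k j ≤ L k * (2 * j + 1)) ∧ ∀ k, 0 < L k := by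
  -- The exponents grow fast enough that `2 ^ k * N k ≤ 2 ^ w k`: family `k` occupies a `2 ^ (-w k)`
  -- share of the indices and so costs at most `2 ^ (-k)` per index on average.
  let w : ℕ → ℕ := fun k => k + ∑ j ∈ Finset.range (k + 1), N j
  have hw : StrictMono w := strictMono_nat_of_lt_succ fun k => by
    simp only [w, Finset.sum_range_succ _ (k + 1)]; omega
  have hwk : ∀ k, k + N k ≤ w k := fun k => by
    simp only [w, Finset.sum_range_succ]; omega
  have hD : ∀ k, 2 ^ k * N k ≤ 2 ^ w k := fun k =>
    calc 2 ^ k * N k ≤ 2 ^ k * 2 ^ N k := Nat.mul_le_mul_left _ Nat.lt_two_pow_self.le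
      _ = 2 ^ (k + N k) := (pow_add _ _ _).symm
      _ ≤ 2 ^ w k := Nat.pow_le_pow_right two_pos (hwk k)
  -- `c i` is the radius reserved around index `i`, and `pos i` the centre when these blocks are
  -- laid end to end. Family `k` takes the indices `I k j` of 2-adic valuation exactly `w k`, so
  -- distinct families are disjoint.
  let c : ℕ → ℕ := fun i => ∑ k ∈ Finset.range i, if 2 ^ w k ∣ i then N k else 0
  let pos : ℕ → ℕ := fun i => ∑ j ∈ Finset.range i, 2 * c j + c i
  let I : ℕ → ℕ → ℕ := fun k j => 2 ^ w k * (2 * j + 1)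
  have hI : ∀ k j, 2 ^ w k ≤ I k j := fun k j => Nat.le_mul_of_pos_right _ (by omega)
  have hc : ∀ k j, N k ≤ c (I k j) := by
    intro k j
    have hk : k < I k j := by
      have h1 : w k < 2 ^ w k := Nat.lt_two_pow_self
      have := hI k j
      have := hwk k
      omega
    have := Finset.single_le_sum (f := fun k' => if 2 ^ w k' ∣ I k j then N k' else 0)
      (fun _ _ => Nat.zero_le _) (Finset.mem_range.2 hk)
    simpa [I] using this
  have hpos : ∀ i i', i < i' → pos i + (c i + c i') ≤ pos i' := by
    intro i i' hii
    have : ∑ j ∈ Finset.range (i + 1), 2 * c j ≤ ∑ j ∈ Finset.range i', 2 * c j :=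
      Finset.sum_le_sum_of_subset (Finset.range_mono hii)
    rw [Finset.sum_range_succ] at this
    simp only [pos]
    omega
  -- The radii are bounded on average, whence `pos i ≤ 4 * i`.
  have hcs : ∀ i, ∑ j ∈ Finset.range (i + 1), c j ≤ 2 * i := by
    intro i
    calc ∑ j ∈ Finset.range (i + 1), c j
        ≤ ∑ j ∈ Finset.range (i + 1), ∑ k ∈ Finset.range i,
            if j ≠ 0 ∧ 2 ^ w k ∣ j then N k else 0 := by
          refine Finset.sum_le_sum fun j hj => ?_
          have hji : j ≤ i := Nat.lt_succ_iff.1 (Finset.mem_range.1 hj)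
          rcases Nat.eq_zero_or_pos j with rfl | hj0
          · simp [c]
          · refine (Finset.sum_le_sum_of_subset (Finset.range_mono hji)).trans_eq ?_
            simp [hj0.ne']
      _ = ∑ k ∈ Finset.range i, N k * (i / 2 ^ w k) := by
          rw [Finset.sum_comm]
          refine Finset.sum_congr rfl fun k _ => ?_
          rw [← Finset.sum_filter, Finset.sum_const, ← Nat.card_multiples', smul_eq_mul, mul_comm]
      _ ≤ ∑ k ∈ Finset.range i, i / 2 ^ k := by
          refine Finset.sum_le_sum fun k _ => ?_
          rw [Nat.le_div_iff_mul_le (by positivity)]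
          calc N k * (i / 2 ^ w k) * 2 ^ k = (2 ^ k * N k) * (i / 2 ^ w k) := by ring
            _ ≤ 2 ^ w k * (i / 2 ^ w k) := Nat.mul_le_mul_right _ (hD k)
            _ ≤ i := Nat.mul_div_le _ _
      _ ≤ 2 * i := by
          have := Nat.geom_sum_le (b := 2) le_rfl i i
          omega
  have hpos_le : ∀ i, pos i ≤ 4 * i := by
    intro i
    have := hcs i
    rw [Finset.sum_range_succ] at this
    simp only [pos, ← Finset.mul_sum]
    omega
  have hinj : ∀ k j l i, I k j = I l i → k = l ∧ j = i := by
    have hlt : ∀ k j l i, k < l → I k j ≠ I l i := by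
      intro k j l i hkl h
      obtain ⟨d, hd⟩ := Nat.exists_eq_add_of_lt (hw hkl)
      simp only [I, hd, pow_succ, pow_add, mul_assoc] at h
      have := Nat.eq_of_mul_eq_mul_left (by positivity) h
      have h2 : 2 ^ d * (2 * (2 * i + 1)) = 2 * (2 ^ d * (2 * i + 1)) := by ring
      omega
    intro k j l i h
    rcases lt_trichotomy k l with hkl | rfl | hkl
    · exact absurd h (hlt _ _ _ _ hkl)
    · have := Nat.eq_of_mul_eq_mul_left (by positivity) h
      omega
    · exact absurd h.symm (hlt _ _ _ _ hkl)
  refine ⟨fun k j => pos (I k j), fun k => 4 * 2 ^ w k, ?_, ?_, ?_, fun k => by positivity⟩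
  · intro k j
    exact (hc k j).trans (Nat.le_add_left _ _)
  · intro k j l i hne
    have h1 := hc k j
    have h2 := hc l i
    rcases lt_trichotomy (I k j) (I l i) with h | h | h
    · have := hpos _ _ h
      left; dsimp only; omega
    · exact absurd (hinj _ _ _ _ h) (by simpa using hne)
    · have := hpos _ _ h
      right; dsimp only; omega
  · intro k j
    refine (hpos_le _).trans_eq ?_
    simp only [I]; ring

/-- For `n ≥ 2L` the first `⌊n / (2L)⌋` terms are at most `n`, and `n ≤ 4L ⌊n / (2L)⌋`; the density
is at least `1 / (4L)`. -/
theorem lowerDensityNat_pos {A : Set ℕ} {a : ℕ → ℕ} {L : ℕ} (hL : 0 < L)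
    (ha : Function.Injective a) (ha0 : ∀ j, 0 < a j) (haL : ∀ j, a j ≤ L * (2 * j + 1))
    (hA : ∀ j, a j ∈ A) : 0 < lowerDensityNat A := by
  have hpos : (0 : ℝ≥0∞) < ((4 * L : ℕ) : ℝ≥0∞)⁻¹ :=
    ENNReal.inv_pos.2 (ENNReal.natCast_ne_top _)
  refine hpos.trans_le (le_liminf_of_le (by isBoundedDefault) ?_)
  filter_upwards [eventually_ge_atTop (2 * L)] with n hn
  have hn0 : 0 < n := by omega
  have hq : n / (2 * L) ≤ (A ∩ Icc 1 n).ncard := by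
    have hsub : ((Finset.range (n / (2 * L))).image a : Set ℕ) ⊆ A ∩ Icc 1 n := by
      intro m hm
      simp only [Finset.coe_image, Finset.coe_range, mem_image, mem_Iio] at hm
      obtain ⟨j, hj, rfl⟩ := hm
      refine ⟨hA j, ha0 j, (haL j).trans ?_⟩
      have h1 : (j + 1) * (2 * L) ≤ n := (Nat.le_div_iff_mul_le (by omega)).1 hj
      nlinarith
    have := Set.ncard_le_ncard hsub ((finite_Icc 1 n).subset inter_subset_right)
    rwa [Set.ncard_coe_finset, Finset.card_image_of_injective _ ha, Finset.card_range] at this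
  have hle : n ≤ 4 * L * (n / (2 * L)) := by
    have h1 : 1 ≤ n / (2 * L) := (Nat.le_div_iff_mul_le (by omega)).2 (by omega)
    have h2 := Nat.lt_mul_div_succ n (show 0 < 2 * L by omega)
    nlinarith
  rw [ENNReal.le_div_iff_mul_le (.inl (by exact_mod_cast hn0.ne'))
    (.inl (ENNReal.natCast_ne_top _)), mul_comm, ← div_eq_mul_inv]
  refine ENNReal.div_le_of_le_mul ?_
  calc (n : ℝ≥0∞) ≤ ((4 * L * (n / (2 * L)) : ℕ) : ℝ≥0∞) := by exact_mod_cast hle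
    _ ≤ _ := by
      rw [mul_comm, Nat.cast_mul]
      gcongr

/-- The intervals `[a j * t₀, a j * t₀ + δ]` are disjoint, since the `a j` are distinct integers and
`δ < t₀`. Counting as in the discrete case gives density at least `δ / (4 L t₀)`. -/
theorem lowerDensityReal_pos {A : Set ℝ≥0} {a : ℕ → ℕ} {L : ℕ} (hL : 0 < L)
    (ha : Function.Injective a) (haL : ∀ j, a j ≤ L * (2 * j + 1)) {t₀ δ : ℝ≥0} (hδ : 0 < δ)
    (hδt : δ < t₀) (hA : ∀ j, ∀ s ≤ δ, a j * t₀ + s ∈ A) : 0 < lowerDensityReal A := by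
  have ht₀ : 0 < t₀ := hδ.trans hδt
  have hLt : 0 < 2 * L * t₀ := by positivity
  have hpos : (0 : ℝ≥0∞) < ((δ / (4 * L * t₀) : ℝ≥0) : ℝ≥0∞) := by
    rw [ENNReal.coe_pos]; positivity
  refine hpos.trans_le (le_liminf_of_le (by isBoundedDefault) ?_)
  filter_upwards [eventually_ge_atTop (2 * L * t₀)] with t ht
  have ht0 : 0 < t := hLt.trans_le ht
  let q := ⌊t / (2 * L * t₀)⌋₊
  have hq1 : 1 ≤ q := Nat.le_floor (by
    rw [Nat.cast_one, one_le_div hLt]; exact ht)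
  have hq2 : q * (2 * L * t₀) ≤ t :=
    (le_div_iff₀ hLt).1 (Nat.floor_le (zero_le (a := t / (2 * L * t₀))))
  have hq3 : t ≤ 4 * L * t₀ * q := by
    have h1 : t < (q + 1) * (2 * L * t₀) := (div_lt_iff₀ hLt).1 (Nat.lt_floor_add_one _)
    have h2 : ((1 : ℕ) : ℝ≥0) ≤ q := by exact_mod_cast hq1
    calc t ≤ (q + 1) * (2 * L * t₀) := h1.le
      _ ≤ (q + q) * (2 * L * t₀) := by gcongr; simpa using h2
      _ = _ := by ring
  let J : ℕ → Set ℝ := fun j => Icc (a j * t₀ : ℝ) (a j * t₀ + δ)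
  have hsub : (⋃ j ∈ Finset.range q, J j) ⊆ (fun s : ℝ≥0 => (s : ℝ)) '' (A ∩ Iic t) := by
    intro x hx
    simp only [mem_iUnion, Finset.mem_range] at hx
    obtain ⟨j, hj, hx1, hx2⟩ := hx
    obtain ⟨s, hs⟩ : ∃ s : ℝ≥0, (s : ℝ) = x - a j * t₀ := ⟨⟨_, by linarith⟩, rfl⟩
    refine ⟨a j * t₀ + s, ⟨hA j _ ?_, ?_⟩, ?_⟩
    · rw [← NNReal.coe_le_coe]; linarith
    · rw [mem_Iic, ← NNReal.coe_le_coe]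
      push_cast
      have h1 : ((a j + 1 : ℕ) : ℝ) ≤ (q * (2 * L) : ℕ) := by
        have := haL j
        have : a j + 1 ≤ (j + 1) * (2 * L) := by nlinarith
        exact_mod_cast this.trans (Nat.mul_le_mul_right _ hj)
      have h2 : (q * (2 * L * t₀) : ℝ) ≤ t := by exact_mod_cast hq2
      have h3 : (δ : ℝ) ≤ t₀ := by exact_mod_cast hδt.le
      push_cast at h1
      nlinarith [mul_le_mul_of_nonneg_right h1 t₀.2]
    · push_cast
      linarith
  have hdisj : (↑(Finset.range q) : Set ℕ).PairwiseDisjoint J := by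
    have hlt : ∀ i j, a i < a j → Disjoint (J i) (J j) := by
      intro i j hij
      rw [Set.disjoint_left]
      rintro x ⟨-, hx⟩ ⟨hx', -⟩
      have h1 : (a i + 1 : ℝ) ≤ a j := by exact_mod_cast hij
      have h3 : (δ : ℝ) < t₀ := by exact_mod_cast hδt
      nlinarith [mul_le_mul_of_nonneg_right h1 t₀.2]
    intro i _ j _ hij
    rcases lt_or_gt_of_ne (ha.ne hij) with h | h
    · exact hlt i j h
    · exact (hlt j i h).symm
  have hvol : (q * δ : ℝ≥0) ≤ MeasureTheory.volume (⋃ j ∈ Finset.range q, J j) := by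
    rw [MeasureTheory.measure_biUnion_finset hdisj fun j _ => measurableSet_Icc]
    simp [J]
  rw [ENNReal.le_div_iff_mul_le (.inl (by exact_mod_cast ht0.ne')) (.inl ENNReal.coe_ne_top)]
  refine le_trans ?_ (hvol.trans (MeasureTheory.measure_mono hsub))
  rw [← ENNReal.coe_mul, ENNReal.coe_le_coe, div_mul_eq_mul_div, div_le_iff₀ (by positivity)]
  calc δ * t ≤ δ * (4 * L * t₀ * q) := by gcongr
    _ = _ := by ring

end Positions

/-! ### Locally dominated series of weak mild solutions. -/

section Series

variable {E : Type*} [AddCommGroup E] [Module ℂ E] [UniformSpace E] [IsUniformAddGroup E]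
  [ContinuousSMul ℂ E]

omit [UniformSpace E] [IsUniformAddGroup E] [ContinuousSMul ℂ E] in
theorem Seminorm.finset_sup_apply_le_sum (p : SeminormFamily ℂ E ℕ) (s : Finset ℕ) (x : E) :
    s.sup p x ≤ ∑ q ∈ s, p q x :=
  Seminorm.finset_sup_apply_le (Finset.sum_nonneg fun _ _ => apply_nonneg _ _) fun _ hq =>
    Finset.single_le_sum (f := fun q => p q x) (fun _ _ => apply_nonneg _ _) hq

omit [UniformSpace E] [IsUniformAddGroup E] [ContinuousSMul ℂ E] in
theorem Seminorm.map_finset_sum_le (q : Seminorm ℂ E) {ι : Type*} (x : ι → E) (t : Finset ι) :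
    q (∑ i ∈ t, x i) ≤ ∑ i ∈ t, q (x i) :=
  Finset.le_sum_of_subadditive q (map_zero q).le (map_add_le_add q) t x

omit [ContinuousSMul ℂ E] in
theorem summable_of_seminorm [CompleteSpace E] {p : SeminormFamily ℂ E ℕ} (hp : WithSeminorms p)
    {ι : Type*} {x : ι → E} (h : ∀ q, Summable fun i => p q (x i)) : Summable x := by
  classical
  rw [summable_iff_vanishing]
  intro U hU
  obtain ⟨s, r, hr, hs⟩ := (hp.mem_nhds_iff 0 U).1 hU
  have hsum : Summable fun i => ∑ q ∈ s, p q (x i) := summable_sum fun q _ => h q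
  obtain ⟨t, ht⟩ := (summable_iff_vanishing_norm.1 hsum) r hr
  refine ⟨t, fun t' ht' => hs ?_⟩
  rw [Seminorm.mem_ball_zero]
  refine lt_of_le_of_lt ?_ (ht t' ht')
  refine le_trans ?_ (le_abs_self _)
  refine (Seminorm.finset_sup_apply_le_sum p s _).trans ?_
  rw [Finset.sum_comm]
  exact Finset.sum_le_sum fun q _ => (p q).map_finset_sum_le x t'

omit [IsUniformAddGroup E] [ContinuousSMul ℂ E] in
theorem Seminorm.le_tsum {q : Seminorm ℂ E} (hq : Continuous q) {ι : Type*} {x : ι → E} {s : E}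
    (hs : HasSum x s) (h : Summable fun i => q (x i)) : q s ≤ ∑' i, q (x i) :=
  le_of_tendsto' ((hq.tendsto s).comp hs) fun t =>
    (q.map_finset_sum_le x t).trans (h.sum_le_tsum t fun _ _ => apply_nonneg q _)

/-- A family of curves whose seminorms are summable, locally uniformly in time. -/
def LocallyDominated (p : SeminormFamily ℂ E ℕ) {ι : Type*} (x : ι → ℝ → E) : Prop :=
  ∀ q R, ∃ g : ι → ℝ, Summable g ∧ ∀ i t, |t| ≤ R → p q (x i t) ≤ g i

/-- `u' = A u` on the whole line in the weak sense: tested on functionals that annihilate the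
graph. -/
def IsWeakMild (A : E →ₗ.[ℂ] E) (u : ℝ → E) : Prop :=
  ∀ φ ψ : E →L[ℂ] ℂ, (∀ a b, (a, b) ∈ A.graph → φ a + ψ b = 0) → ∀ a b : ℝ,
    (∫ s in a..b, φ (u s)) + ψ (u b - u a) = 0

namespace LocallyDominated

variable {p : SeminormFamily ℂ E ℕ} {ι : Type*} {x : ι → ℝ → E}

omit [IsUniformAddGroup E] [ContinuousSMul ℂ E] in
theorem of_continuous_seminorm (hx : LocallyDominated p x) (hp : WithSeminorms p)
    {Q : Seminorm ℂ E} (hQ : Continuous Q) (R : ℝ) :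
    ∃ g : ι → ℝ, Summable g ∧ ∀ i t, |t| ≤ R → Q (x i t) ≤ g i := by
  obtain ⟨s, C, -, hC⟩ := Seminorm.bound_of_continuous hp Q hQ
  choose g hg hgx using fun q => hx q R
  refine ⟨fun i => C * ∑ q ∈ s, g q i, (summable_sum fun q _ => hg q).mul_left _,
    fun i t ht => (hC _).trans ?_⟩
  rw [smul_apply, NNReal.smul_def, smul_eq_mul]
  refine mul_le_mul_of_nonneg_left ?_ C.2
  refine (Seminorm.finset_sup_apply_le_sum p s _).trans ?_
  exact Finset.sum_le_sum fun q _ => hgx q i t ht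

variable [CompleteSpace E]

omit [ContinuousSMul ℂ E] in
theorem summable (hx : LocallyDominated p x) (hp : WithSeminorms p) (t : ℝ) :
    Summable fun i => x i t :=
  summable_of_seminorm hp fun q => by
    obtain ⟨g, hg, hgx⟩ := hx q |t|
    exact hg.of_nonneg_of_le (fun i => apply_nonneg _ _) fun i => hgx i t le_rfl

omit [ContinuousSMul ℂ E] in
-- The `q`-distance of the sums at `t` and `t₀` is at most `∑ p q (x i t - x i t₀)`, a scalar series
-- that converges uniformly near `t₀` and vanishes at `t₀`.
theorem continuous_tsum [T2Space E] (hx : LocallyDominated p x) (hp : WithSeminorms p)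
    (hc : ∀ i, Continuous (x i)) : Continuous fun t => ∑' i, x i t := by
  rw [continuous_iff_continuousAt]
  intro t₀
  rw [ContinuousAt, hp.tendsto_nhds]
  intro q ε hε
  obtain ⟨g, hg, hgx⟩ := hx q (|t₀| + 1)
  have hb : ∀ i t, |t| ≤ |t₀| + 1 → p q (x i t - x i t₀) ≤ 2 * g i := fun i t ht => by
    have h1 := map_sub_le_add (p q) (x i t) (x i t₀)
    linarith [hgx i t ht, hgx i t₀ (by linarith)]
  have hcont : ContinuousOn (fun t => ∑' i, p q (x i t - x i t₀)) {t | |t| ≤ |t₀| + 1} := by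
    refine continuousOn_tsum (u := fun i => 2 * g i) (fun i => ?_) (hg.mul_left 2)
      fun i t ht => ?_
    · exact ((hp.continuous_seminorm q).comp ((hc i).sub continuous_const)).continuousOn
    · rw [Real.norm_of_nonneg (apply_nonneg _ _)]
      exact hb i t ht
  have hnhds : {t : ℝ | |t| ≤ |t₀| + 1} ∈ 𝓝 t₀ :=
    (continuous_abs.continuousAt.eventually_lt continuousAt_const (by simp)).mono fun _ h => h.le
  have hlim := (hcont.continuousAt hnhds).eventually_lt (continuousAt_const (y := ε)) (by simpa)
  filter_upwards [hlim, hnhds] with t ht ht'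
  refine lt_of_le_of_lt ?_ ht
  refine Seminorm.le_tsum (hp.continuous_seminorm q)
    ((hx.summable hp t).hasSum.sub (hx.summable hp t₀).hasSum) ?_
  exact (hg.mul_left 2).of_nonneg_of_le (fun i => apply_nonneg _ _) fun i => hb i t ht'

omit [ContinuousSMul ℂ E] in
theorem isWeakMild_tsum [T2Space E] [Countable ι] (hx : LocallyDominated p x)
    (hp : WithSeminorms p) (hc : ∀ i, Continuous (x i)) {A : E →ₗ.[ℂ] E}
    (hA : ∀ i, IsWeakMild A (x i)) : IsWeakMild A fun t => ∑' i, x i t := by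
  intro φ ψ h a b
  obtain ⟨g, hg, hgx⟩ := hx.of_continuous_seminorm hp (Q := φ.toSeminorm) φ.continuous.norm
    (max |a| |b|)
  have h1 : HasSum (fun i => ∫ s in a..b, φ (x i s)) (∫ s in a..b, φ (∑' i, x i s)) := by
    refine intervalIntegral.hasSum_integral_of_dominated_convergence (fun i _ => g i)
      (fun i => (φ.continuous.comp (hc i)).aestronglyMeasurable) ?_ (by simp [hg]) (by simp) ?_
    · refine fun i => .of_forall fun t ht => hgx i t ?_
      have := uIoc_subset_uIcc ht
      rw [mem_uIcc] at this
      rcases this with h | h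
      · exact abs_le_max_abs_abs h.1 h.2
      · rw [max_comm]; exact abs_le_max_abs_abs h.1 h.2
    · exact .of_forall fun t _ => (hx.summable hp t).hasSum.mapL φ
  have h2 : HasSum (fun i => ψ (x i b - x i a)) (ψ (∑' i, x i b - ∑' i, x i a)) :=
    ((hx.summable hp b).hasSum.sub (hx.summable hp a).hasSum).mapL ψ
  refine (h1.add h2).unique ?_
  simp only [hA _ φ ψ h a b]
  exact hasSum_zero

end LocallyDominated

namespace IsWeakMild

variable {A : E →ₗ.[ℂ] E} {u v : ℝ → E}

omit [IsUniformAddGroup E] [ContinuousSMul ℂ E] in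
theorem zero : IsWeakMild A (0 : ℝ → E) := fun φ ψ _ a b => by simp

omit [IsUniformAddGroup E] [ContinuousSMul ℂ E] in
theorem add (hu : IsWeakMild A u) (hv : IsWeakMild A v) (huc : Continuous u) (hvc : Continuous v) :
    IsWeakMild A (u + v) := by
  intro φ ψ h a b
  simp only [Pi.add_apply, map_add, map_sub]
  have hi : ∀ w : ℝ → E, Continuous w → IntervalIntegrable (fun s => φ (w s))
      MeasureTheory.volume a b := fun w hw => (φ.continuous.comp hw).intervalIntegrable _ _
  rw [intervalIntegral.integral_add (hi u huc) (hi v hvc)]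
  have h1 := hu φ ψ h a b
  have h2 := hv φ ψ h a b
  simp only [map_sub] at h1 h2
  linear_combination h1 + h2

omit [IsUniformAddGroup E] [ContinuousSMul ℂ E] in
theorem smul (hu : IsWeakMild A u) (c : ℂ) : IsWeakMild A (c • u) := by
  intro φ ψ h a b
  have h1 := hu φ ψ h a b
  simp only [Pi.smul_apply, ← smul_sub, map_smul, smul_eq_mul,
    intervalIntegral.integral_const_mul, ← mul_add, h1, mul_zero]

omit [IsUniformAddGroup E] [ContinuousSMul ℂ E] in
theorem comp_add (hu : IsWeakMild A u) (c : ℝ) : IsWeakMild A fun t => u (c + t) := by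
  intro φ ψ h a b
  rw [intervalIntegral.integral_comp_add_left (fun t => φ (u t)) c]
  exact hu φ ψ h _ _

theorem isMildSolution [LocallyConvexSpace ℝ E] [PolynormableSpace ℂ E] [CompleteSpace E]
    (hA : A.IsClosed) (hu : IsWeakMild A u) (huc : Continuous u) :
    IsMildSolution A (u 0) fun t : ℝ≥0 => u t := by
  refine ⟨by fun_prop, fun t => ?_⟩
  obtain ⟨y, hy⟩ := exists_weakIntegral huc t.2
  refine ⟨y, fun φ => ?_, LinearPMap.mem_graph_of_forall_annihilator hA fun φ ψ h => ?_⟩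
  · refine (hy φ).trans (intervalIntegral.integral_congr fun s hs => ?_)
    rw [uIcc_of_le t.2] at hs
    simp only [Real.coe_toNNReal s hs.1]
  · rw [hy φ]
    exact hu φ ψ h 0 t

end IsWeakMild

end Series

/-! ### Quadratic decay of oscillatory integrals. -/

section OscillatoryIntegral

/-- Two integrations by parts, with no boundary terms because `h` and `h'` vanish at both ends. -/
theorem sq_mul_integral_exp_mul_eq {h h' h'' : ℝ → ℂ} {a b : ℝ} (hab : a ≤ b)
    (hc : ContinuousOn h (Icc a b)) (hc' : ContinuousOn h' (Icc a b))
    (hc'' : ContinuousOn h'' (Icc a b)) (hd : ∀ s ∈ Ioo a b, HasDerivAt h (h' s) s)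
    (hd' : ∀ s ∈ Ioo a b, HasDerivAt h' (h'' s) s) (ha : h a = 0) (hb : h b = 0)
    (ha' : h' a = 0) (hb' : h' b = 0) (t : ℝ) :
    (Complex.I * t) ^ 2 * ∫ s in a..b, Complex.exp (Complex.I * t * s) * h s
      = ∫ s in a..b, Complex.exp (Complex.I * t * s) * h'' s := by
  have step : ∀ k k' : ℝ → ℂ, ContinuousOn k (Icc a b) → ContinuousOn k' (Icc a b) →
      (∀ s ∈ Ioo a b, HasDerivAt k (k' s) s) → k a = 0 → k b = 0 →
      (Complex.I * t) * ∫ s in a..b, Complex.exp (Complex.I * t * s) * k s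
        = - ∫ s in a..b, Complex.exp (Complex.I * t * s) * k' s := by
    intro k k' hk hk' hkd hka hkb
    have he : ∀ s : ℝ, HasDerivAt (fun s : ℝ => Complex.exp (Complex.I * t * s))
        (Complex.exp (Complex.I * t * s) * (Complex.I * t)) s := by
      intro s
      have h1 : HasDerivAt (fun s : ℝ => Complex.I * t * (s : ℂ)) (Complex.I * t) s := by
        simpa using (Complex.ofRealCLM.hasDerivAt (x := s)).const_mul (Complex.I * t)
      exact h1.cexp
    have hcont : Continuous fun s : ℝ => Complex.exp (Complex.I * t * s) := by fun_prop
    have := intervalIntegral.integral_mul_deriv_eq_deriv_mul_of_hasDerivAt (a := a) (b := b)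
      (u := k) (u' := k') (v := fun s : ℝ => Complex.exp (Complex.I * t * s))
      (v' := fun s : ℝ => Complex.exp (Complex.I * t * s) * (Complex.I * t))
      (by rwa [uIcc_of_le hab]) hcont.continuousOn
      (by rw [min_eq_left hab, max_eq_right hab]; exact hkd) (fun s _ => he s)
      (ContinuousOn.intervalIntegrable (by rwa [uIcc_of_le hab]))
      (Continuous.intervalIntegrable (by fun_prop) _ _)
    rw [hka, hkb, zero_mul, zero_mul, sub_zero, zero_sub] at this
    rw [← intervalIntegral.integral_const_mul]
    simp only [mul_comm (Complex.exp _) (k' _)]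
    rw [← this]
    refine intervalIntegral.integral_congr fun s _ => ?_
    ring
  rw [pow_two, mul_assoc, step h h' hc hc' hd ha hb, mul_neg, step h' h'' hc' hc'' hd' ha' hb',
    neg_neg]

/-- A weight vanishing to second order at both endpoints of `[a, b]`. -/
noncomputable def bumpWeight (a b s : ℝ) : ℝ := (s - a) ^ 2 * (b - s) ^ 2

/-- What matters is that `K` depends only on `a`, `b` and `M`: the bound is later applied to all
functionals dominated by one seminorm at once. -/
theorem exists_sq_mul_integral_bumpWeight_le {a b : ℝ} (hab : a ≤ b) {M : ℝ} : ∃ K : ℝ,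
    ∀ ψ ψ' ψ'' : ℝ → ℂ, ContinuousOn ψ (Icc a b) → ContinuousOn ψ' (Icc a b) →
      ContinuousOn ψ'' (Icc a b) → (∀ s ∈ Ioo a b, HasDerivAt ψ (ψ' s) s) →
      (∀ s ∈ Ioo a b, HasDerivAt ψ' (ψ'' s) s) →
      (∀ s ∈ Icc a b, ‖ψ s‖ ≤ M ∧ ‖ψ' s‖ ≤ M ∧ ‖ψ'' s‖ ≤ M) → ∀ t : ℝ,
      ‖∫ s in a..b, Complex.exp (Complex.I * t * s) * (bumpWeight a b s * ψ s)‖ * (1 + t ^ 2)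
        ≤ K := by
  let g₁ : ℝ → ℝ := fun s => 2 * (s - a) * (b - s) ^ 2 - 2 * (s - a) ^ 2 * (b - s)
  let g₂ : ℝ → ℝ := fun s => 2 * (b - s) ^ 2 - 8 * (s - a) * (b - s) + 2 * (s - a) ^ 2
  have hg0 : Continuous (bumpWeight a b) := by unfold bumpWeight; fun_prop
  have hg1 : Continuous g₁ := by fun_prop
  have hg2 : Continuous g₂ := by fun_prop
  have hgd : ∀ s, HasDerivAt (bumpWeight a b) (g₁ s) s := by
    intro s
    have h1 : HasDerivAt (fun s => (s - a) ^ 2) (2 * (s - a)) s := by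
      simpa using ((hasDerivAt_id s).sub_const a).fun_pow 2
    have h2 : HasDerivAt (fun s => (b - s) ^ 2) (-(2 * (b - s))) s := by
      simpa using ((hasDerivAt_id s).const_sub b).fun_pow 2
    refine (h1.mul h2).congr_deriv ?_
    simp only [g₁]; ring
  have hgd' : ∀ s, HasDerivAt g₁ (g₂ s) s := by
    intro s
    have h1 : HasDerivAt (fun s => s - a) 1 s := (hasDerivAt_id s).sub_const a
    have h2 : HasDerivAt (fun s => b - s) (-1) s := (hasDerivAt_id s).const_sub b
    refine (((h1.const_mul 2).mul (h2.fun_pow 2)).sub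
      (((h1.fun_pow 2).const_mul 2).mul h2)).congr_deriv ?_
    simp only [g₂, Nat.cast_ofNat, Nat.add_one_sub_one, pow_one]; ring
  obtain ⟨G, hG⟩ := isCompact_Icc.exists_bound_of_continuousOn (s := Icc a b)
    (f := fun s => |bumpWeight a b s| + |g₁ s| + |g₂ s|) (by fun_prop)
  have hGs : ∀ s ∈ Icc a b, |bumpWeight a b s| ≤ G ∧ |g₁ s| ≤ G ∧ |g₂ s| ≤ G := by
    intro s hs
    have h1 := (le_abs_self _).trans (hG s hs)
    have h2 := abs_nonneg (bumpWeight a b s)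
    have h3 := abs_nonneg (g₁ s)
    have h4 := abs_nonneg (g₂ s)
    exact ⟨by linarith, by linarith, by linarith⟩
  -- The first term is the trivial bound; the second bounds the four products in the second
  -- derivative of weight times `ψ`.
  refine ⟨G * M * (b - a) + 4 * (G * M) * (b - a), ?_⟩
  intro ψ ψ' ψ'' hc hc' hc'' hd hd' hM t
  have hexp : ∀ s : ℝ, ‖Complex.exp (Complex.I * t * s)‖ = 1 := fun s => by
    rw [mul_assoc, ← Complex.ofReal_mul, mul_comm]; exact Complex.norm_exp_ofReal_mul_I _
  have hG0 : 0 ≤ G := (abs_nonneg _).trans (hGs a ⟨le_rfl, hab⟩).1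
  have hM0 : 0 ≤ M := (norm_nonneg _).trans (hM a ⟨le_rfl, hab⟩).1
  have hmul : ∀ (x : ℝ) (z : ℂ), |x| ≤ G → ‖z‖ ≤ M → ‖(x : ℂ) * z‖ ≤ G * M := by
    intro x z hx hz
    rw [norm_mul, Complex.norm_real, Real.norm_eq_abs]
    exact mul_le_mul hx hz (norm_nonneg _) hG0
  have hI : ∀ s ∈ uIoc a b, s ∈ Icc a b := fun s hs => by
    rw [uIoc_of_le hab] at hs; exact ⟨hs.1.le, hs.2⟩
  have hba : |b - a| = b - a := abs_of_nonneg (by linarith)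
  have hy0 : ‖∫ s in a..b, Complex.exp (Complex.I * t * s) * (bumpWeight a b s * ψ s)‖
      ≤ G * M * (b - a) := by
    rw [← hba]
    refine intervalIntegral.norm_integral_le_of_norm_le_const fun s hs => ?_
    rw [norm_mul, hexp, one_mul]
    exact hmul _ _ (hGs s (hI s hs)).1 (hM s (hI s hs)).1
  have hofR : ∀ {k : ℝ → ℝ}, Continuous k → ContinuousOn (fun s => (k s : ℂ)) (Icc a b) :=
    fun hk => (Complex.continuous_ofReal.comp hk).continuousOn
  have hparts := sq_mul_integral_exp_mul_eq (h := fun s => bumpWeight a b s * ψ s)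
    (h' := fun s => g₁ s * ψ s + bumpWeight a b s * ψ' s)
    (h'' := fun s => (g₂ s * ψ s + g₁ s * ψ' s) + (g₁ s * ψ' s + bumpWeight a b s * ψ'' s)) hab
    ((hofR hg0).mul hc) (((hofR hg1).mul hc).add ((hofR hg0).mul hc'))
    ((((hofR hg2).mul hc).add ((hofR hg1).mul hc')).add
      (((hofR hg1).mul hc').add ((hofR hg0).mul hc'')))
    (fun s hs => (hgd s).ofReal_comp.mul (hd s hs))
    (fun s hs => ((hgd' s).ofReal_comp.mul (hd s hs)).add ((hgd s).ofReal_comp.mul (hd' s hs)))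
    (by simp [bumpWeight]) (by simp [bumpWeight]) (by simp [bumpWeight, g₁])
    (by simp [bumpWeight, g₁]) t
  have hy2 : t ^ 2 * ‖∫ s in a..b, Complex.exp (Complex.I * t * s) * (bumpWeight a b s * ψ s)‖
      ≤ 4 * (G * M) * (b - a) := by
    have hn : ‖(Complex.I * (t : ℂ)) ^ 2‖ = t ^ 2 := by
      simp
    rw [← hn, ← norm_mul, hparts, ← hba]
    refine intervalIntegral.norm_integral_le_of_norm_le_const fun s hs => ?_
    rw [norm_mul, hexp, one_mul]
    obtain ⟨h1, h2, h3⟩ := hGs s (hI s hs)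
    obtain ⟨h4, h5, h6⟩ := hM s (hI s hs)
    refine (norm_add_le _ _).trans ?_
    have e1 := (norm_add_le ((g₂ s : ℂ) * ψ s) (g₁ s * ψ' s)).trans
      (add_le_add (hmul _ _ h3 h4) (hmul _ _ h2 h5))
    have e2 := (norm_add_le ((g₁ s : ℂ) * ψ' s) (bumpWeight a b s * ψ'' s)).trans
      (add_le_add (hmul _ _ h2 h5) (hmul _ _ h1 h6))
    linarith
  linarith

end OscillatoryIntegral

/-! ### Wave packets as decaying solutions. -/

section DecayingSolutions

variable {E : Type*} [AddCommGroup E] [Module ℂ E] [UniformSpace E] [IsUniformAddGroup E]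
  [ContinuousSMul ℂ E]

/-- An entire weak mild solution with values in `F` that decays quadratically at `±∞`. -/
structure IsDecayingSolution (p : SeminormFamily ℂ E ℕ) (A : E →ₗ.[ℂ] E) (F : Submodule ℂ E)
    (y : ℝ → E) : Prop where
  continuous : Continuous y
  mem : ∀ t, y t ∈ F
  isWeakMild : IsWeakMild A y
  decay : ∀ q, ∃ M, ∀ t : ℝ, p q (y t) * (1 + t ^ 2) ≤ M

namespace IsDecayingSolution

variable {p : SeminormFamily ℂ E ℕ} {A : E →ₗ.[ℂ] E} {F : Submodule ℂ E} {y z : ℝ → E}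

omit [IsUniformAddGroup E] [ContinuousSMul ℂ E] in
theorem zero : IsDecayingSolution p A F (0 : ℝ → E) :=
  ⟨continuous_const, fun _ => F.zero_mem, .zero, fun q => ⟨0, fun t => by simp⟩⟩

omit [ContinuousSMul ℂ E] in
theorem add (hy : IsDecayingSolution p A F y) (hz : IsDecayingSolution p A F z) :
    IsDecayingSolution p A F (y + z) := by
  refine ⟨hy.continuous.add hz.continuous, fun t => F.add_mem (hy.mem t) (hz.mem t),
    hy.isWeakMild.add hz.isWeakMild hy.continuous hz.continuous, fun q => ?_⟩
  obtain ⟨M, hM⟩ := hy.decay q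
  obtain ⟨M', hM'⟩ := hz.decay q
  refine ⟨M + M', fun t => ?_⟩
  have h1 : p q ((y + z) t) ≤ p q (y t) + p q (z t) := map_add_le_add _ _ _
  nlinarith [hM t, hM' t, mul_le_mul_of_nonneg_right h1 (by positivity : 0 ≤ 1 + t ^ 2)]

omit [IsUniformAddGroup E] in
theorem smul (hy : IsDecayingSolution p A F y) (c : ℂ) : IsDecayingSolution p A F (c • y) := by
  refine ⟨hy.continuous.const_smul c, fun t => F.smul_mem c (hy.mem t), hy.isWeakMild.smul c,
    fun q => ?_⟩
  obtain ⟨M, hM⟩ := hy.decay q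
  refine ⟨‖c‖ * M, fun t => ?_⟩
  rw [Pi.smul_apply, map_smul_eq_mul, mul_assoc]
  exact mul_le_mul_of_nonneg_left (hM t) (norm_nonneg c)

variable (p A F) in
/-- The initial values of the decaying solutions. -/
def initialValues : Submodule ℂ E where
  carrier := {x | ∃ y, IsDecayingSolution p A F y ∧ y 0 = x}
  zero_mem' := ⟨0, zero, rfl⟩
  add_mem' := by
    rintro _ _ ⟨y, hy, rfl⟩ ⟨z, hz, rfl⟩
    exact ⟨y + z, hy.add hz, rfl⟩
  smul_mem' := by
    rintro c _ ⟨y, hy, rfl⟩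
    exact ⟨c • y, hy.smul c, rfl⟩

end IsDecayingSolution

theorem norm_exp_I_mul_sub_exp_I_mul_le (t t' s : ℝ) :
    ‖Complex.exp (Complex.I * t * s) - Complex.exp (Complex.I * t' * s)‖ ≤ |t - t'| * |s| := by
  have h : Complex.exp (Complex.I * t * s) - Complex.exp (Complex.I * t' * s)
      = Complex.exp ((t' * s : ℝ) * Complex.I)
        * (Complex.exp (Complex.I * ((t - t') * s : ℝ)) - 1) := by
    rw [mul_sub, ← Complex.exp_add, mul_one]
    congr 2 <;> push_cast <;> ring
  rw [h, norm_mul, Complex.norm_exp_ofReal_mul_I, one_mul, ← abs_mul]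
  exact Real.norm_exp_I_mul_ofReal_sub_one_le

theorem integral_exp_I_mul (s t₁ t₂ : ℝ) :
    Complex.I * s * ∫ t in t₁..t₂, Complex.exp (Complex.I * t * s)
      = Complex.exp (Complex.I * t₂ * s) - Complex.exp (Complex.I * t₁ * s) := by
  rw [← intervalIntegral.integral_const_mul]
  refine intervalIntegral.integral_eq_sub_of_hasDerivAt
    (f := fun t : ℝ => Complex.exp (Complex.I * t * s)) (fun t _ => ?_)
    (Continuous.intervalIntegrable (by fun_prop) _ _)
  have h1 : HasDerivAt (fun t : ℝ => Complex.I * (t : ℂ) * s) (Complex.I * s) t := by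
    simpa using ((Complex.ofRealCLM.hasDerivAt (x := t)).const_mul Complex.I).mul_const (s : ℂ)
  exact h1.cexp.congr_deriv (mul_comm _ _)

variable [LocallyConvexSpace ℝ E] [PolynormableSpace ℂ E] [CompleteSpace E]

theorem exists_isDecayingSolution {p : SeminormFamily ℂ E ℕ} (hp : WithSeminorms p)
    {A : E →ₗ.[ℂ] E} {F : Submodule ℂ E} (hF : IsClosed (F : Set E)) {f f' f'' : ℝ → E} {a b : ℝ}
    (hab : a ≤ b) (hf : ContinuousOn f (Icc a b)) (hf' : ContinuousOn f' (Icc a b))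
    (hf'' : ContinuousOn f'' (Icc a b))
    (hd : ∀ φ : E →L[ℂ] ℂ, ∀ s ∈ Ioo a b, HasDerivAt (fun s => φ (f s)) (φ (f' s)) s)
    (hd' : ∀ φ : E →L[ℂ] ℂ, ∀ s ∈ Ioo a b, HasDerivAt (fun s => φ (f' s)) (φ (f'' s)) s)
    (hfF : ∀ s ∈ Icc a b, f s ∈ F)
    (hfA : ∀ s ∈ Icc a b, (f s, (Complex.I * (s : ℂ)) • f s) ∈ A.graph) :
    ∃ y, IsDecayingSolution p A F y ∧
      ∀ φ : E →L[ℂ] ℂ, φ (y 0) = ∫ s in a..b, bumpWeight a b s * φ (f s) := by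
  -- Constant extension beyond `[a, b]` makes the integrand continuous on `ℝ`.
  let f₀ : ℝ → E := IccExtend hab fun s : Icc a b => f s
  have hf₀c : Continuous f₀ := hf.domRestrict.Icc_extend'
  have hf₀ : ∀ s ∈ uIcc a b, f₀ s = f s := fun s hs => by
    rw [uIcc_of_le hab] at hs; exact IccExtend_of_mem hab _ hs
  have hw : Continuous (bumpWeight a b) := by unfold bumpWeight; fun_prop
  choose y hy using fun t : ℝ => exists_weakIntegral
    (u := fun s => (Complex.exp (Complex.I * t * s) * bumpWeight a b s) • f₀ s) (by fun_prop) hab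
  have hy : ∀ t (φ : E →L[ℂ] ℂ),
      φ (y t) = ∫ s in a..b, Complex.exp (Complex.I * t * s) * (bumpWeight a b s * φ (f s)) := by
    intro t φ
    rw [hy t φ]
    refine intervalIntegral.integral_congr fun s hs => ?_
    simp only [map_smul, smul_eq_mul, hf₀ s hs, mul_assoc]
  have hI : ∀ s ∈ uIoc a b, s ∈ Icc a b := fun s hs => by
    rw [uIoc_of_le hab] at hs; exact ⟨hs.1.le, hs.2⟩
  have hint : ∀ t (φ : E →L[ℂ] ℂ), IntervalIntegrable (fun s : ℝ =>
      Complex.exp (Complex.I * t * s) * (bumpWeight a b s * φ (f s)))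
      MeasureTheory.volume a b := by
    intro t φ
    refine ContinuousOn.intervalIntegrable ?_
    rw [uIcc_of_le hab]
    have : ContinuousOn (fun s => φ (f s)) (Icc a b) := φ.continuous.comp_continuousOn hf
    fun_prop
  refine ⟨y, ⟨?_, ?_, ?_, ?_⟩, fun φ => by simpa using hy 0 φ⟩
  · rw [continuous_iff_continuousAt]
    intro t₀
    rw [ContinuousAt, hp.tendsto_nhds]
    intro q ε hε
    obtain ⟨K, hK⟩ := isCompact_Icc.exists_bound_of_continuousOn (s := Icc a b)
      (f := fun s => |s| * (|bumpWeight a b s| * p q (f s)))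
      (continuousOn_id.abs.mul (hw.continuousOn.abs.mul
        ((hp.continuous_seminorm q).comp_continuousOn hf)))
    have hlip : ∀ t, p q (y t - y t₀) ≤ |t - t₀| * K * |b - a| := by
      intro t
      refine Seminorm.le_of_forall_dual (hp.continuous_seminorm q) fun φ hφ => ?_
      rw [map_sub, hy, hy, ← intervalIntegral.integral_sub (hint t φ) (hint t₀ φ)]
      refine intervalIntegral.norm_integral_le_of_norm_le_const fun s hs => ?_
      rw [← sub_mul, norm_mul, norm_mul, Complex.norm_real, Real.norm_eq_abs]
      calc _ ≤ |t - t₀| * |s| * (|bumpWeight a b s| * p q (f s)) := by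
            gcongr
            · exact norm_exp_I_mul_sub_exp_I_mul_le _ _ _
            · exact hφ _
        _ = |t - t₀| * (|s| * (|bumpWeight a b s| * p q (f s))) := by ring
        _ ≤ |t - t₀| * K := by
            gcongr
            exact (le_abs_self _).trans (hK s (hI s hs))
    have hlim : Tendsto (fun t => |t - t₀| * K * |b - a|) (𝓝 t₀) (𝓝 0) := by
      have : Continuous fun t => |t - t₀| * K * |b - a| := by fun_prop
      simpa using this.tendsto t₀
    filter_upwards [hlim.eventually_lt_const hε] with t ht
    exact (hlip t).trans_lt ht
  · refine fun t => Submodule.mem_of_forall_annihilator hF fun φ hφ => ?_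
    rw [hy, intervalIntegral.integral_congr (g := fun _ => (0 : ℂ))]
    · simp
    · intro s hs
      rw [uIcc_of_le hab] at hs
      simp [hφ _ (hfF s hs)]
  -- The eigenvalue relation gives `φ (f s) = -i s ψ (f s)`; after Fubini, the time integral of `i s
  -- e^{its}` is the increment of `e^{its}`, which cancels `ψ (y t₂ - y t₁)`.
  · intro φ ψ h t₁ t₂
    have heig : ∀ s ∈ uIcc a b, φ (f s) = -(Complex.I * s * ψ (f s)) := by
      intro s hs
      rw [uIcc_of_le hab] at hs
      have := h _ _ (hfA s hs)
      rw [map_smul, smul_eq_mul] at this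
      linear_combination this
    have h1 : ∀ t, φ (y t)
        = ∫ s in a..b, Complex.exp (Complex.I * t * s) * (bumpWeight a b s * φ (f₀ s)) := by
      intro t
      rw [hy]
      refine intervalIntegral.integral_congr fun s hs => ?_
      simp only [hf₀ s hs]
    simp only [h1]
    rw [MeasureTheory.intervalIntegral_intervalIntegral_swap (F := fun t s : ℝ =>
      Complex.exp (Complex.I * t * s) * (bumpWeight a b s * φ (f₀ s)))]
    · rw [map_sub, hy, hy, ← intervalIntegral.integral_sub (hint t₂ ψ) (hint t₁ ψ),
        intervalIntegral.integral_congr (g := fun s : ℝ =>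
          -(Complex.exp (Complex.I * t₂ * s) * (bumpWeight a b s * ψ (f s))
            - Complex.exp (Complex.I * t₁ * s) * (bumpWeight a b s * ψ (f s)))),
        intervalIntegral.integral_neg, neg_add_cancel]
      intro s hs
      simp only
      rw [intervalIntegral.integral_mul_const, hf₀ s hs, heig s hs, ← sub_mul,
        ← integral_exp_I_mul]
      ring
    · refine (ContinuousOn.integrableOn_compact (isCompact_uIcc.prod isCompact_uIcc)
        (Continuous.continuousOn ?_)).mono_set (prod_mono uIoc_subset_uIcc uIoc_subset_uIcc)
      simp only [Function.uncurry_def]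
      fun_prop
  · intro q
    obtain ⟨M, hM⟩ := isCompact_Icc.exists_bound_of_continuousOn (s := Icc a b)
      (f := fun s => p q (f s) + p q (f' s) + p q (f'' s))
      ((((hp.continuous_seminorm q).comp_continuousOn hf).add
        ((hp.continuous_seminorm q).comp_continuousOn hf')).add
        ((hp.continuous_seminorm q).comp_continuousOn hf''))
    obtain ⟨K, hK⟩ := exists_sq_mul_integral_bumpWeight_le hab (M := M)
    refine ⟨K, fun t => ?_⟩
    rw [← le_div_iff₀ (by positivity)]
    refine Seminorm.le_of_forall_dual (hp.continuous_seminorm q) fun φ hφ => ?_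
    rw [le_div_iff₀ (by positivity), hy]
    refine hK (fun s => φ (f s)) (fun s => φ (f' s)) (fun s => φ (f'' s))
      (φ.continuous.comp_continuousOn hf) (φ.continuous.comp_continuousOn hf')
      (φ.continuous.comp_continuousOn hf'') (hd φ) (hd' φ) (fun s hs => ?_) t
    have h0 := (le_abs_self _).trans (hM s hs)
    have h1 := apply_nonneg (p q) (f s)
    have h2 := apply_nonneg (p q) (f' s)
    have h3 := apply_nonneg (p q) (f'' s)
    exact ⟨(hφ _).trans (by linarith), (hφ _).trans (by linarith), (hφ _).trans (by linarith)⟩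

end DecayingSolutions

/-! ### Density of the initial values of decaying solutions. -/

section EigenvectorFields

variable {E : Type*} [AddCommGroup E] [Module ℂ E] [UniformSpace E] [IsUniformAddGroup E]
  [ContinuousSMul ℂ E]

omit [IsUniformAddGroup E] [ContinuousSMul ℂ E] in
theorem hasDerivWithinAt_dual_of_tendsto {g : ℝ → E} {d : E} {I : Set ℝ} {t : ℝ}
    (h : Tendsto (fun s : ℝ => ((s - t : ℝ) : ℂ)⁻¹ • (g s - g t)) (𝓝[I \ {t}] t) (𝓝 d))
    (φ : E →L[ℂ] ℂ) : HasDerivWithinAt (fun s => φ (g s)) (φ d) I t := by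
  rw [hasDerivWithinAt_iff_tendsto_slope]
  refine ((φ.continuous.tendsto d).comp h).congr fun s => ?_
  simp [slope_def_module, Complex.real_smul]

theorem continuousWithinAt_of_tendsto_slope {g : ℝ → E} {d : E} {I : Set ℝ} {t : ℝ}
    (h : Tendsto (fun s : ℝ => ((s - t : ℝ) : ℂ)⁻¹ • (g s - g t)) (𝓝[I \ {t}] t) (𝓝 d)) :
    ContinuousWithinAt g I t := by
  rw [← continuousWithinAt_sdiff_self]
  have h1 : Tendsto (fun s : ℝ => ((s - t : ℝ) : ℂ)) (𝓝[I \ {t}] t) (𝓝 0) := by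
    have : Continuous fun s : ℝ => ((s - t : ℝ) : ℂ) := by fun_prop
    simpa using (this.tendsto t).mono_left nhdsWithin_le_nhds
  have h2 := (h1.smul h).add_const (g t)
  rw [zero_smul, zero_add] at h2
  refine h2.congr' ?_
  filter_upwards [self_mem_nhdsWithin] with s hs
  have : ((s - t : ℝ) : ℂ) ≠ 0 := by
    exact_mod_cast sub_ne_zero.2 hs.2
  rw [smul_smul, mul_inv_cancel₀ this, one_smul, sub_add_cancel]

variable [LocallyConvexSpace ℝ E] [PolynormableSpace ℂ E] [CompleteSpace E]

theorem IsC2On.exists_isDecayingSolution {p : SeminormFamily ℂ E ℕ} (hp : WithSeminorms p)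
    {A : E →ₗ.[ℂ] E} {F : Submodule ℂ E} (hF : IsClosed (F : Set E)) {f : ℝ → E} {I : Set ℝ}
    (hf : IsC2On f I) (hfF : ∀ s ∈ I, f s ∈ F)
    (hfA : ∀ s ∈ I, (f s, (Complex.I * (s : ℂ)) • f s) ∈ A.graph) {a b : ℝ} (hab : a ≤ b)
    (hI : Icc a b ⊆ I) :
    ∃ y, IsDecayingSolution p A F y ∧
      ∀ φ : E →L[ℂ] ℂ, φ (y 0) = ∫ s in a..b, bumpWeight a b s * φ (f s) := by
  obtain ⟨f', f'', h1, h2, h3⟩ := hf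
  have hnhds : ∀ s ∈ Ioo a b, I ∈ 𝓝 s := fun s hs =>
    mem_of_superset (Icc_mem_nhds hs.1 hs.2) hI
  exact _root_.exists_isDecayingSolution hp hF (f' := f') (f'' := f'') hab
    (fun s hs => (continuousWithinAt_of_tendsto_slope (h1 s (hI hs))).mono hI)
    (fun s hs => (continuousWithinAt_of_tendsto_slope (h2 s (hI hs))).mono hI) (h3.mono hI)
    (fun φ s hs => (hasDerivWithinAt_dual_of_tendsto
      (h1 s (hI ⟨hs.1.le, hs.2.le⟩)) φ).hasDerivAt (hnhds s hs))
    (fun φ s hs => (hasDerivWithinAt_dual_of_tendsto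
      (h2 s (hI ⟨hs.1.le, hs.2.le⟩)) φ).hasDerivAt (hnhds s hs))
    (fun s hs => hfF s (hI hs)) (fun s hs => hfA s (hI hs))

/-- The point `s` may be an endpoint of `I`, so the interval is taken on one side of `s`, towards
another point of `I`. -/
theorem exists_Icc_subset_of_ordConnected {I U : Set ℝ} (hI : I.OrdConnected) (hI' : I.Nontrivial)
    {s : ℝ} (hs : s ∈ I) (hU : U ∈ 𝓝[I] s) : ∃ a b, a < b ∧ Icc a b ⊆ I ∩ U := by
  obtain ⟨r, hr, hne⟩ := hI'.exists_ne s
  obtain ⟨ε, hε, hεU⟩ := Metric.mem_nhdsWithin_iff.1 hU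
  have key : ∀ a b, a < b → Icc a b ⊆ I → (∀ x ∈ Icc a b, |x - s| < ε) →
      ∃ a b, a < b ∧ Icc a b ⊆ I ∩ U := fun a b hab h1 h2 =>
    ⟨a, b, hab, fun x hx => ⟨h1 hx, hεU ⟨by rw [Metric.mem_ball, Real.dist_eq]; exact h2 x hx,
      h1 hx⟩⟩⟩
  rcases lt_or_gt_of_ne hne with h | h
  · refine key (max r (s - ε / 2)) s (max_lt h (by linarith))
      ((Icc_subset_Icc_left (le_max_left _ _)).trans (hI.out hr hs)) fun x hx => ?_
    have := (le_max_right r (s - ε / 2)).trans hx.1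
    rw [abs_lt]
    constructor <;> linarith [hx.2]
  · refine key s (min r (s + ε / 2)) (lt_min h (by linarith))
      ((Icc_subset_Icc_right (min_le_left _ _)).trans (hI.out hs hr)) fun x hx => ?_
    have := hx.2.trans (min_le_right r (s + ε / 2))
    rw [abs_lt]
    constructor <;> linarith [hx.1]

/-- Suppose `φ` kills all initial values but `φ (f j s₀) ≠ 0`. Near `s₀` the real part of `conj (φ
(f j s₀)) * φ (f j s)` is positive, so its integral against the positive weight over a small
interval cannot vanish; yet it comes from `φ (y 0) = 0`. -/
theorem fieldSpan_le_closure_initialValues {p : SeminormFamily ℂ E ℕ} (hp : WithSeminorms p)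
    {A : E →ₗ.[ℂ] E} {F : Submodule ℂ E} (hF : IsClosed (F : Set E)) {Γ : Type*} {I : Γ → Set ℝ}
    {f : Γ → ℝ → E} (hI : ∀ j, (I j).OrdConnected) (hI' : ∀ j, (I j).Nontrivial)
    (hf : ∀ j, IsC2On (f j) (I j)) (hfF : ∀ j, ∀ t ∈ I j, f j t ∈ F)
    (hAf : ∀ j, ∀ t ∈ I j, (f j t, (Complex.I * (t : ℂ)) • f j t) ∈ A.graph) :
    fieldSpan I f ≤ (IsDecayingSolution.initialValues p A F).topologicalClosure := by
  refine Submodule.span_le.2 ?_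
  rintro _ ⟨j, s₀, hs₀, rfl⟩
  refine Submodule.mem_of_forall_annihilator (Submodule.isClosed_topologicalClosure _)
    fun φ hφ => ?_
  by_contra hne
  let c := starRingEnd ℂ (φ (f j s₀))
  have hcont : ContinuousOn (fun s => φ (f j s)) (I j) := by
    obtain ⟨f', f'', h1, -, -⟩ := hf j
    exact fun s hs => (hasDerivWithinAt_dual_of_tendsto (h1 s hs) φ).continuousWithinAt
  have hcont' : ContinuousOn (fun s => (c * φ (f j s)).re) (I j) :=
    Complex.continuous_re.comp_continuousOn (continuousOn_const.mul hcont)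
  have hpos : 0 < (c * φ (f j s₀)).re := by
    rw [← Complex.normSq_eq_conj_mul_self, Complex.ofReal_re]
    exact Complex.normSq_pos.2 hne
  obtain ⟨a, b, hab, hsub⟩ := exists_Icc_subset_of_ordConnected (hI j) (hI' j) hs₀
    ((hcont' s₀ hs₀).eventually_const_lt hpos)
  obtain ⟨y, hy, hy0⟩ := (hf j).exists_isDecayingSolution hp hF (hfF j) (hAf j) hab.le
    fun s hs => (hsub hs).1
  have hzero : ∫ s in a..b, bumpWeight a b s * φ (f j s) = 0 := by
    rw [← hy0]
    exact hφ _ (Submodule.le_topologicalClosure _ ⟨y, hy, rfl⟩)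
  have hw : Continuous (bumpWeight a b) := by unfold bumpWeight; fun_prop
  have hre : ∫ s in a..b, bumpWeight a b s * (c * φ (f j s)).re = 0 := by
    have hi : IntervalIntegrable (fun s => c * (bumpWeight a b s * φ (f j s)))
        MeasureTheory.volume a b := by
      refine ContinuousOn.intervalIntegrable ?_
      rw [uIcc_of_le hab.le]
      exact continuousOn_const.mul ((Complex.continuous_ofReal.comp hw).continuousOn.mul
        (hcont.mono fun s hs => (hsub hs).1))
    have h1 := Complex.reCLM.intervalIntegral_comp_comm hi
    rw [intervalIntegral.integral_const_mul, hzero, mul_zero, map_zero] at h1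
    rw [← h1]
    refine intervalIntegral.integral_congr fun s _ => ?_
    simp only [Complex.reCLM_apply]
    rw [mul_left_comm, Complex.re_ofReal_mul]
  refine absurd hre (ne_of_gt (intervalIntegral.intervalIntegral_pos_of_pos_on ?_ ?_ hab))
  · refine ContinuousOn.intervalIntegrable ?_
    rw [uIcc_of_le hab.le]
    exact hw.continuousOn.mul (hcont'.mono fun s hs => (hsub hs).1)
  · intro s hs
    refine mul_pos ?_ (hsub ⟨hs.1.le, hs.2.le⟩).2
    exact mul_pos (pow_pos (sub_pos.2 hs.1) 2) (pow_pos (sub_pos.2 hs.2) 2)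

end EigenvectorFields

/-! ### Superposition of translated decaying solutions. -/

section Superposition

theorem summable_prod_of_sum_le {g : ℕ × ℕ → ℝ} (hg : 0 ≤ g) {β : ℕ → ℝ} (hβ : Summable β)
    (h : ∀ l (s : Finset ℕ), ∑ i ∈ s, g (l, i) ≤ β l) : Summable g ∧ ∑' z, g z ≤ ∑' l, β l := by
  have h1 : ∀ l, Summable fun i => g (l, i) := fun l =>
    summable_of_sum_le (fun i => hg (l, i)) (h l)
  have h2 : ∀ l, ∑' i, g (l, i) ≤ β l := fun l =>
    Real.tsum_le_of_sum_le (fun i => hg (l, i)) (h l)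
  have h3 : Summable fun l => ∑' i, g (l, i) :=
    hβ.of_nonneg_of_le (fun l => tsum_nonneg fun i => hg (l, i)) h2
  have h4 : Summable g := (summable_prod_of_nonneg hg).2 ⟨h1, h3⟩
  exact ⟨h4, by rw [h4.tsum_prod]; exact h3.tsum_le_tsum h2 hβ⟩

theorem Summable.eventually_tail_sum_le {b : ℤ → ℝ} (hb : Summable b) {ε : ℝ} (hε : 0 < ε) :
    ∀ᶠ N : ℕ in atTop, ∀ s : Finset ℤ, (∀ m ∈ s, (N : ℤ) ≤ |m|) → ∑ m ∈ s, b m ≤ ε := by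
  obtain ⟨t, ht⟩ := summable_iff_vanishing_norm.1 hb ε hε
  filter_upwards [eventually_gt_atTop (t.sup Int.natAbs)] with N hN s hs
  refine (le_abs_self _).trans (ht s ?_).le
  rw [Finset.disjoint_left]
  intro m hm hmt
  have h1 := hs m hm
  have h2 := Finset.le_sup (f := Int.natAbs) hmt
  rw [Int.abs_eq_natAbs] at h1
  omega

theorem summable_inv_one_add_sq_int : Summable fun m : ℤ => (1 + (m : ℝ) ^ 2)⁻¹ := by
  refine Summable.of_norm_bounded_eventually (g := fun m : ℤ => 1 / (m : ℝ) ^ 2)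
    (Real.summable_one_div_int_pow.2 one_lt_two) ?_
  filter_upwards [(Set.finite_singleton (0 : ℤ)).compl_mem_cofinite] with m hm
  have hm0 : (0 : ℝ) < (m : ℝ) ^ 2 := by
    have : (m : ℝ) ≠ 0 := by exact_mod_cast hm
    positivity
  rw [Real.norm_of_nonneg (by positivity), one_div]
  exact inv_anti₀ hm0 (by linarith)

variable {E : Type*} [AddCommGroup E] [Module ℂ E] [UniformSpace E] [IsUniformAddGroup E]
  [ContinuousSMul ℂ E] {p : SeminormFamily ℂ E ℕ} {A : E →ₗ.[ℂ] E} {F : Submodule ℂ E}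

omit [IsUniformAddGroup E] [ContinuousSMul ℂ E] in
-- From `|m| ≤ |t| / t₀ + 1` follows `1 + m² ≤ (3 + 2 / t₀²) (1 + t²)`, so quadratic decay gives a
-- summable bound on the grid `t₀ ℤ`.
theorem IsDecayingSolution.exists_summable_bound {y : ℝ → E} (hy : IsDecayingSolution p A F y)
    (q : ℕ) {t₀ : ℝ} (ht₀ : 0 < t₀) : ∃ b : ℤ → ℝ, Summable b ∧
      ∀ (m : ℤ) (t : ℝ), |t - m * t₀| ≤ t₀ → p q (y t) ≤ b m := by
  obtain ⟨M, hM⟩ := hy.decay q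
  refine ⟨fun m => M * (3 + 2 / t₀ ^ 2) * (1 + (m : ℝ) ^ 2)⁻¹,
    summable_inv_one_add_sq_int.mul_left _, fun m t ht => ?_⟩
  dsimp only
  rw [← div_eq_mul_inv, le_div_iff₀ (by positivity)]
  have h1 : 1 + (m : ℝ) ^ 2 ≤ (3 + 2 / t₀ ^ 2) * (1 + t ^ 2) := by
    have h2 : |(m : ℝ)| ≤ |t| / t₀ + 1 := by
      rw [← sub_le_iff_le_add, le_div_iff₀ ht₀]
      have h3 : |(m : ℝ) * t₀| ≤ |t| + t₀ := by
        calc |(m : ℝ) * t₀| = |t - (t - m * t₀)| := by ring_nf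
          _ ≤ |t| + |t - m * t₀| := abs_sub _ _
          _ ≤ |t| + t₀ := by linarith
      rw [abs_mul, abs_of_pos ht₀] at h3
      linarith
    have h4 : (m : ℝ) ^ 2 ≤ (|t| / t₀ + 1) ^ 2 := by
      rw [← sq_abs]
      exact pow_le_pow_left₀ (abs_nonneg _) h2 2
    have h5 : (|t| / t₀ + 1) ^ 2 ≤ 2 * (t ^ 2 / t₀ ^ 2) + 2 := by
      have : t ^ 2 / t₀ ^ 2 = (|t| / t₀) ^ 2 := by rw [div_pow, sq_abs]
      nlinarith [sq_nonneg (|t| / t₀ - 1)]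
    have h6 : (3 + 2 / t₀ ^ 2) * (1 + t ^ 2)
        = 3 + 3 * t ^ 2 + 2 / t₀ ^ 2 + 2 * (t ^ 2 / t₀ ^ 2) := by ring
    have h7 : 0 ≤ 2 / t₀ ^ 2 := by positivity
    nlinarith [sq_nonneg t]
  calc p q (y t) * (1 + (m : ℝ) ^ 2)
      ≤ p q (y t) * ((3 + 2 / t₀ ^ 2) * (1 + t ^ 2)) :=
        mul_le_mul_of_nonneg_left h1 (apply_nonneg _ _)
    _ = p q (y t) * (1 + t ^ 2) * (3 + 2 / t₀ ^ 2) := by ring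
    _ ≤ M * (3 + 2 / t₀ ^ 2) := mul_le_mul_of_nonneg_right (hM t) (by positivity)

/-- A solution following, near times of positive lower density, each of given decaying
solutions. -/
theorem exists_superposition [T2Space E] [CompleteSpace E] (hp : WithSeminorms p)
    (hF : IsClosed (F : Set E)) {y : ℕ → ℝ → E} (hy : ∀ k, IsDecayingSolution p A F (y k)) {t₀ : ℝ}
    (ht₀ : 0 < t₀) : ∃ (u : ℝ → E) (n : ℕ → ℕ → ℕ) (L : ℕ → ℕ),
      Continuous u ∧ (∀ t, u t ∈ F) ∧ IsWeakMild A u ∧ (∀ k, Function.Injective (n k)) ∧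
      (∀ k j, 0 < n k j) ∧ (∀ k, 0 < L k) ∧ (∀ k j, n k j ≤ L k * (2 * j + 1)) ∧
      ∀ q k, q ≤ k → ∀ j h, |h| ≤ t₀ →
        p q (u (n k j * t₀ + h) - y k h) ≤ 2 * (1 / 2) ^ k := by
  choose b hb hby using fun l q => (hy l).exists_summable_bound q ht₀
  have hb0 : ∀ l q m, 0 ≤ b l q m := fun l q m =>
    (apply_nonneg (p q) _).trans (hby l q m (m * t₀) (by simpa using ht₀.le))
  have htail : ∀ k, ∃ N : ℕ, ∀ l ∈ Iic k, ∀ q ∈ Iic k, ∀ s : Finset ℤ,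
      (∀ m ∈ s, (N : ℤ) ≤ |m|) → ∑ m ∈ s, b l q m ≤ (1 / 4) ^ k := by
    intro k
    refine Eventually.exists (f := atTop) ?_
    rw [(finite_Iic k).eventually_all]
    intro l _
    rw [(finite_Iic k).eventually_all]
    exact fun q _ => (hb l q).eventually_tail_sum_le (by positivity)
  choose N' hN' using htail
  have htail' : ∀ k l q, l ≤ k → q ≤ k → ∀ (s : Finset ℕ) (v : ℕ → ℤ), InjOn v s →
      (∀ i ∈ s, (N' k : ℤ) ≤ |v i|) → ∑ i ∈ s, b l q (v i) ≤ (1 / 4) ^ k := by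
    intro k l q hl hq s v hv h
    rw [← Finset.sum_image (f := b l q) hv]
    refine hN' k l hl q hq _ fun m hm => ?_
    obtain ⟨i, hi, rfl⟩ := Finset.mem_image.1 hm
    exact h i hi
  -- `N' k` controls interference. The extra `k` keeps `n k j` at distance at least `N' k` from any
  -- `m` with `|m| ≤ k`, and the 1 makes positions positive.
  obtain ⟨n, L, hn, hsep, hnL, hL⟩ := exists_separated_positions fun k => N' k + k + 1
  have hinj : ∀ k, Function.Injective (n k) := by
    intro k i j hij
    by_contra hne
    rcases hsep k i k j (by simpa using hne) with h | h <;> omega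
  have hinj' : ∀ k (m : ℤ), Function.Injective fun i => m - n k i := by
    intro k m i j hij
    exact hinj k (by simpa using hij)
  let x : ℕ × ℕ → ℝ → E := fun z t => y z.1 (t - n z.1 z.2 * t₀)
  have hxb : ∀ z q (m : ℤ) t, |t - m * t₀| ≤ t₀ → p q (x z t) ≤ b z.1 q (m - n z.1 z.2) := by
    intro z q m t ht
    refine hby _ _ _ _ ?_
    push_cast
    rwa [show t - n z.1 z.2 * t₀ - (m - n z.1 z.2) * t₀ = t - m * t₀ by ring]
  have hsum : ∀ q (m : ℤ), Summable fun z : ℕ × ℕ => b z.1 q (m - n z.1 z.2) := by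
    intro q m
    -- For `l ≥ max q |m|` every position in family `l` is at least `N' l` away from `m`, giving a
    -- geometric bound; the finitely many other `l` are charged their full sum.
    let β : ℕ → ℝ := fun l => (1 / 4) ^ l + if l ∈ Finset.range (max q m.natAbs) then
      ∑' m', b l q m' else 0
    refine (summable_prod_of_sum_le (β := β) (fun z => hb0 _ _ _) ?_ fun l s => ?_).1
    · refine (summable_geometric_of_lt_one (by norm_num) (by norm_num)).add ?_
      exact summable_of_ne_finset_zero (s := Finset.range (max q m.natAbs)) fun l hl => if_neg hl
    · by_cases hl : l ∈ Finset.range (max q m.natAbs)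
      · simp only [β, if_pos hl]
        have h1 : ∑ i ∈ s, b l q (m - n l i) ≤ ∑' m', b l q m' := by
          rw [← Finset.sum_image (f := b l q) (hinj' l m).injOn]
          exact (hb l q).sum_le_tsum _ fun _ _ => hb0 _ _ _
        have : (0 : ℝ) ≤ (1 / 4) ^ l := by positivity
        linarith
      · simp only [β, if_neg hl, add_zero]
        rw [Finset.mem_range, not_lt, max_le_iff] at hl
        refine htail' l l q le_rfl hl.1 s _ (hinj' l m).injOn fun i _ => ?_
        have := hn l i
        rw [Int.abs_eq_natAbs]
        omega
  have hdom : LocallyDominated p x := by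
    -- Each `|t| ≤ R` is within `t₀` of a grid point `m t₀` with `|m| ≤ K`; summing over these `m`
    -- removes the dependence on `t`.
    intro q R
    let K : ℕ := ⌈R / t₀⌉₊ + 1
    refine ⟨fun z => ∑ m ∈ Finset.Icc (-K : ℤ) K, b z.1 q (m - n z.1 z.2),
      summable_sum fun m _ => hsum q m, fun z t ht => ?_⟩
    have hr : |t - round (t / t₀) * t₀| ≤ t₀ := by
      have h1 := abs_sub_round (t / t₀)
      have h2 : t - round (t / t₀) * t₀ = (t / t₀ - round (t / t₀)) * t₀ := by field_simp
      rw [h2, abs_mul, abs_of_pos ht₀]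
      nlinarith
    have hK : |(round (t / t₀) : ℝ)| ≤ K := by
      have h1 := abs_sub_round (t / t₀)
      have h2 : |t / t₀| ≤ R / t₀ := by
        rw [abs_div, abs_of_pos ht₀]; gcongr
      have h3 := Nat.le_ceil (R / t₀)
      simp only [K]
      push_cast
      rw [abs_le] at *
      constructor <;> linarith
    have hK' : |round (t / t₀)| ≤ (K : ℤ) := by exact_mod_cast hK
    refine (hxb z q _ t hr).trans ?_
    exact Finset.single_le_sum (f := fun m : ℤ => b z.1 q (m - n z.1 z.2)) (fun _ _ => hb0 _ _ _)
      (Finset.mem_Icc.2 (abs_le.1 hK'))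
  have hxc : ∀ z, Continuous (x z) := fun z =>
    (hy z.1).continuous.comp (f := fun t => t - n z.1 z.2 * t₀) (by fun_prop)
  refine ⟨fun t => ∑' z, x z t, n, L, hdom.continuous_tsum hp hxc, fun t => ?_,
    hdom.isWeakMild_tsum hp hxc fun z => ?_, hinj, fun k j => ?_, hL, hnL, ?_⟩
  · exact hF.mem_of_tendsto (hdom.summable hp t).hasSum
      (.of_forall fun s => F.sum_mem fun z _ => (hy z.1).mem _)
  · have := (hy z.1).isWeakMild.comp_add (-(n z.1 z.2 * t₀))
    simpa only [x, neg_add_eq_sub] using this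
  · have := hn k j
    omega
  · intro q k hqk j h hh
    set t : ℝ := n k j * t₀ + h with ht
    -- Removing the term `(k, j)` leaves the interference of all other terms.
    have hs := (hdom.summable hp t).hasSum.sub (hasSum_ite_eq (k, j) (x (k, j) t))
    have hxkj : x (k, j) t = y k h := by simp [x, ht]
    rw [← hxkj]
    let g : ℕ × ℕ → ℝ := fun z => if z = (k, j) then 0 else b z.1 q (n k j - n z.1 z.2)
    have hgle : ∀ z, p q (x z t - if z = (k, j) then x (k, j) t else 0) ≤ g z := by
      intro z
      by_cases hz : z = (k, j)
      · simp [g, hz]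
      · simp only [g, if_neg hz, sub_zero]
        exact hxb z q (n k j) t (by simpa [ht] using hh)
    have hg0 : 0 ≤ g := fun z => (apply_nonneg _ _).trans (hgle z)
    have hgs := summable_prod_of_sum_le (g := g) (β := fun l => (1 / 2) ^ k * (1 / 2) ^ l) hg0
      ((summable_geometric_of_lt_one (by norm_num) (by norm_num)).mul_left _) (by
        intro l s
        have h1 : ∑ i ∈ s, g (l, i)
            = ∑ i ∈ s with (l, i) ≠ (k, j), b l q (n k j - n l i) := by
          rw [Finset.sum_filter]
          refine Finset.sum_congr rfl fun i _ => ?_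
          by_cases hi : (l, i) = (k, j) <;> simp [g, hi]
        rw [h1]
        -- Separation at level `max k l` yields `4 ^ (-max k l) ≤ 2 ^ (-k) * 2 ^ (-l)`, and the sum
        -- over `l` is `2 * 2 ^ (-k)`.
        refine (htail' (max k l) l q (le_max_right _ _) (hqk.trans (le_max_left _ _)) _ _
          (hinj' l (n k j)).injOn fun i hi => ?_).trans ?_
        · have h2 := hsep l i k j (Finset.mem_filter.1 hi).2
          rw [Int.abs_eq_natAbs]
          rcases le_total k l with hkl | hkl
          · rw [max_eq_right hkl]; omega
          · rw [max_eq_left hkl]; omega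
        · have h3 : (1 / 4 : ℝ) ^ max k l = (1 / 2) ^ max k l * (1 / 2) ^ max k l := by
            rw [← mul_pow]; norm_num
          rw [h3]
          refine mul_le_mul ?_ ?_ (by positivity) (by positivity)
          · exact pow_le_pow_of_le_one (by norm_num) (by norm_num) (le_max_left _ _)
          · exact pow_le_pow_of_le_one (by norm_num) (by norm_num) (le_max_right _ _))
    have hps : Summable fun z => p q (x z t - if z = (k, j) then x (k, j) t else 0) :=
      hgs.1.of_nonneg_of_le (fun z => apply_nonneg _ _) hgle
    refine (Seminorm.le_tsum (hp.continuous_seminorm q) hs hps).trans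
      ((hps.tsum_le_tsum hgle hgs.1).trans (hgs.2.trans_eq ?_))
    rw [tsum_mul_left, tsum_geometric_of_lt_one (by norm_num) (by norm_num)]
    norm_num
    ring

end Superposition

/-! ### Frequent hypercyclicity from an orbit. -/

section Orbits

theorem lowerDensityNat_mono {A B : Set ℕ} (h : A ⊆ B) : lowerDensityNat A ≤ lowerDensityNat B := by
  refine liminf_le_liminf (.of_forall fun n => ENNReal.div_le_div_right ?_ _) ?_ ?_
  · exact_mod_cast ncard_le_ncard (inter_subset_inter_left _ h)
      ((finite_Icc 1 n).subset inter_subset_right)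
  all_goals isBoundedDefault

theorem lowerDensityReal_mono {A B : Set ℝ≥0} (h : A ⊆ B) :
    lowerDensityReal A ≤ lowerDensityReal B := by
  refine liminf_le_liminf (.of_forall fun t => ENNReal.div_le_div_right ?_ _) ?_ ?_
  · exact MeasureTheory.measure_mono (image_mono (inter_subset_inter_left _ h))
  all_goals isBoundedDefault

variable {X : Type*} {T : ℝ≥0 → Set (X × X)} {v : ℝ≥0 → X}

/-- The operators are partially defined, so iterating needs the orbit relation from every base point
`c`, not only from 0. -/
theorem mem_opPow_of_orbit (hv : ∀ c t, (v c, v (c + t)) ∈ T t) (t₀ : ℝ≥0) (n : ℕ) :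
    (v 0, v (n * t₀)) ∈ opPow (T t₀) n := by
  induction n with
  | zero => simp [opPow]
  | succ n ih =>
    refine ⟨_, ih, ?_⟩
    have := hv (n * t₀) t₀
    rwa [show (n * t₀ + t₀ : ℝ≥0) = ((n + 1 : ℕ) : ℝ≥0) * t₀ by push_cast; ring] at this

variable [TopologicalSpace X]

theorem frequentlyHypercyclicFamily_of_orbit (hv : ∀ c t, (v c, v (c + t)) ∈ T t)
    (h : ∀ V : Set X, IsOpen V → V.Nonempty → 0 < lowerDensityReal (v ⁻¹' V)) :
    FrequentlyHypercyclicFamily T := by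
  have hv0 : ∀ t, (v 0, v t) ∈ T t := fun t => by simpa using hv 0 t
  exact ⟨v 0, fun t => ⟨_, hv0 t⟩, fun V hV hne => (h V hV hne).trans_le
    (lowerDensityReal_mono fun t ht => ⟨_, ht, hv0 t⟩)⟩

theorem frequentlyHypercyclicOp_of_orbit (hv : ∀ c t, (v c, v (c + t)) ∈ T t) {t₀ : ℝ≥0}
    (h : ∀ V : Set X, IsOpen V → V.Nonempty → 0 < lowerDensityNat {n | v (n * t₀) ∈ V}) :
    FrequentlyHypercyclicOp (T t₀) :=
  ⟨v 0, fun n => ⟨_, mem_opPow_of_orbit hv t₀ n⟩, fun V hV hne => (h V hV hne).trans_le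
    (lowerDensityNat_mono fun n hn => ⟨_, hn, mem_opPow_of_orbit hv t₀ n⟩)⟩

end Orbits

/-! ### A frequently visiting solution. -/

section FrequentVisits

variable {E : Type*} [AddCommGroup E] [Module ℂ E] [UniformSpace E] [IsUniformAddGroup E]
  [ContinuousSMul ℂ E] [T2Space E] [CompleteSpace E]

/-- Some solution with values in `F` visits every open set meeting `F` with positive lower
density. -/
theorem exists_frequentlyVisiting_solution [TopologicalSpace.SeparableSpace E]
    {p : SeminormFamily ℂ E ℕ} (hp : WithSeminorms p) {A : E →ₗ.[ℂ] E} {F : Submodule ℂ E}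
    (hF : IsClosed (F : Set E))
    (hd : F ≤ (IsDecayingSolution.initialValues p A F).topologicalClosure) {t₀ : ℝ≥0}
    (ht₀ : 0 < t₀) : ∃ u : ℝ → E, Continuous u ∧ (∀ t, u t ∈ F) ∧ IsWeakMild A u ∧
      ∀ V : Set E, IsOpen V → (V ∩ F).Nonempty → 0 < lowerDensityReal {t : ℝ≥0 | u t ∈ V} ∧
        0 < lowerDensityNat {n : ℕ | u ((n * t₀ : ℝ≥0) : ℝ) ∈ V} := by
  have := hp.firstCountableTopology
  have : (uniformity E).IsCountablyGenerated := IsUniformAddGroup.uniformity_countably_generated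
  have : SecondCountableTopology E := UniformSpace.secondCountable_of_separable E
  let Y := IsDecayingSolution.initialValues p A F
  have : SecondCountableTopology Y :=
    TopologicalSpace.Subtype.secondCountableTopology (Y : Set E)
  have : TopologicalSpace.SeparableSpace Y := inferInstance
  let z : ℕ → Y := TopologicalSpace.denseSeq Y
  choose y hy hy0 using fun i => (z i).2
  -- Unpairing lists each `y i` at infinitely many indices `k`, so it is followed with arbitrarily
  -- small error.
  obtain ⟨u, n, L, huc, huF, hu, hinj, hn0, hL, hnL, happ⟩ :=
    exists_superposition hp hF (y := fun k => y k.unpair.1) (fun k => hy _) (t₀ := t₀) ht₀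
  refine ⟨u, huc, huF, hu, fun V hV hne => ?_⟩
  obtain ⟨v, hvV, hvF⟩ := hne
  obtain ⟨w, hwV, hwY⟩ := mem_closure_iff.1 (hd hvF) V hV hvV
  obtain ⟨i, hi⟩ := (TopologicalSpace.denseRange_denseSeq Y).exists_mem_open
    (hV.preimage continuous_subtype_val) ⟨⟨w, hwY⟩, hwV⟩
  have hi : y i 0 ∈ V := by rw [hy0]; exact hi
  obtain ⟨s, r, hr, hs⟩ := (hp.mem_nhds_iff _ V).1 (hV.mem_nhds hi)
  have hlim : Tendsto (fun k : ℕ => 2 * (1 / 2 : ℝ) ^ k) atTop (𝓝 0) := by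
    simpa using (tendsto_pow_atTop_nhds_zero_of_lt_one (r := (1 / 2 : ℝ)) (by norm_num)
      (by norm_num)).const_mul 2
  obtain ⟨K, hK⟩ := eventually_atTop.1 ((hlim.eventually_lt_const (half_pos hr)).and
    (eventually_ge_atTop (s.sup id)))
  -- This `k` encodes `y i` and is at least `K`, so the error is below `r / 2` and all seminorms in
  -- `s` are covered.
  let k := Nat.pair i K
  obtain ⟨hk, hks⟩ := hK k (Nat.right_le_pair i K)
  have hki : k.unpair.1 = i := by simp [k]
  have hnear : ∀ᶠ h in 𝓝 (0 : ℝ), y i h ∈ (s.sup p).ball (y i 0) (r / 2) :=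
    ((hy i).continuous.tendsto 0).eventually
      ((hp.mem_nhds_iff _ _).2 ⟨s, r / 2, half_pos hr, Subset.rfl⟩)
  obtain ⟨δ', hδ', hδ'n⟩ := Metric.eventually_nhds_iff.1 hnear
  obtain ⟨δ, hδ, hδm⟩ : ∃ δ : ℝ≥0, 0 < δ ∧ (δ : ℝ) < min δ' t₀ := by
    have : 0 < min δ' (t₀ : ℝ) := lt_min hδ' ht₀
    exact ⟨⟨min δ' t₀ / 2, (half_pos this).le⟩, half_pos this, half_lt_self this⟩
  have hvisit : ∀ j, ∀ h : ℝ, 0 ≤ h → h ≤ δ → u (n k j * t₀ + h) ∈ V := by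
    intro j h h0 hhδ
    refine hs ?_
    rw [Seminorm.mem_ball]
    have h1 : s.sup p (u (n k j * t₀ + h) - y i h) < r / 2 := by
      refine lt_of_le_of_lt (Seminorm.finset_sup_apply_le (by positivity) fun q hq => ?_) hk
      have := happ q k ((Finset.le_sup (f := id) hq).trans hks) j h
        (by rw [abs_of_nonneg h0]; exact hhδ.trans (hδm.trans_le (min_le_right _ _)).le)
      rwa [hki] at this
    have h2 : s.sup p (y i h - y i 0) < r / 2 := by
      refine (Seminorm.mem_ball _).1 (hδ'n ?_)
      rw [Real.dist_eq, sub_zero, abs_of_nonneg h0]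
      exact hhδ.trans_lt (hδm.trans_le (min_le_left _ _))
    calc s.sup p (u (n k j * t₀ + h) - y i 0)
        = s.sup p ((u (n k j * t₀ + h) - y i h) + (y i h - y i 0)) := by rw [sub_add_sub_cancel]
      _ ≤ _ := map_add_le_add _ _ _
      _ < r := by linarith
  refine ⟨lowerDensityReal_pos (hL k) (hinj k) (hnL k) hδ
    (by exact_mod_cast hδm.trans_le (min_le_right _ _)) fun j h hh => ?_,
    lowerDensityNat_pos (hL k) (hinj k) (hn0 k) (hnL k) fun j => ?_⟩
  · have := hvisit j h h.2 (by exact_mod_cast hh)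
    simpa using this
  · have := hvisit j 0 le_rfl δ.2
    simpa using this

end FrequentVisits

/-! ### Weak integrals and mild solutions in closed subspaces. -/

section ClosedSubspaces

variable {E : Type*} [AddCommGroup E] [Module ℂ E]

theorem mem_graph_opPart {A : E →ₗ.[ℂ] E} {F : Submodule ℂ E} {z : F × F} :
    z ∈ (opPart A F).graph ↔ ((z.1 : E), (z.2 : E)) ∈ A.graph := by
  rw [← SetLike.mem_coe, graph_opPart]
  rfl

variable [TopologicalSpace E]

/-- Functionals on `F` extend to `E` by Hahn–Banach. -/
theorem hasIntegral_coe_iff [PolynormableSpace ℂ E] {F : Submodule ℂ E} {w : ℝ≥0 → F} {t : ℝ≥0}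
    {y : F} : HasIntegral (fun s => (w s : E)) t y ↔ HasIntegral w t y := by
  refine ⟨fun h φ => ?_, fun h φ => h (φ.comp F.subtypeL)⟩
  obtain ⟨ψ, hψ⟩ := StrongDual.exists_extension F φ
  simpa only [hψ] using h ψ

variable [IsTopologicalAddGroup E] [ContinuousSMul ℂ E] [LocallyConvexSpace ℝ E]

theorem HasIntegral.mem {F : Submodule ℂ E} (hF : IsClosed (F : Set E)) {u : ℝ≥0 → E}
    (hu : ∀ s, u s ∈ F) {t : ℝ≥0} {y : E} (hy : HasIntegral u t y) : y ∈ F := by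
  refine Submodule.mem_of_forall_annihilator hF fun φ hφ => ?_
  rw [hy φ]
  simp [hφ _ (hu _)]

variable [PolynormableSpace ℂ E]

theorem isMildSolution_coe_iff {A : E →ₗ.[ℂ] E} {F : Submodule ℂ E} (hF : IsClosed (F : Set E))
    {x : F} {w : ℝ≥0 → F} :
    IsMildSolution A (x : E) (fun s => (w s : E)) ↔ IsMildSolution (opPart A F) x w := by
  refine and_congr continuous_induced_rng.symm (forall_congr' fun t => ⟨?_, ?_⟩)
  · rintro ⟨y, hy, hy'⟩
    exact ⟨⟨y, hy.mem hF fun s => (w s).2⟩, hasIntegral_coe_iff.1 hy, mem_graph_opPart.2 hy'⟩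
  · rintro ⟨y, hy, hy'⟩
    exact ⟨y, hasIntegral_coe_iff.2 hy, mem_graph_opPart.1 hy'⟩

end ClosedSubspaces

/-! ### Restriction to an invariant closed subspace. -/

section Parts

variable {E : Type*} [AddCommGroup E] [Module ℂ E] [UniformSpace E] [IsUniformAddGroup E]
  [ContinuousSMul ℂ E] [LocallyConvexSpace ℝ E] [PolynormableSpace ℂ E]
  {A : E →ₗ.[ℂ] E} {C : E →L[ℂ] E} {S : ℝ≥0 → E →L[ℂ] E}

theorem IsSubgenerator.restrict (hA : IsSubgenerator A C S) {F : Submodule ℂ E}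
    (hF : IsClosed (F : Set E)) (hCF : ∀ x ∈ F, C x ∈ F) (hSF : ∀ t, ∀ x ∈ F, S t x ∈ F) :
    IsSubgenerator (opPart A F) (C.restrict hCF) fun t => (S t).restrict (hSF t) where
  isClosed := by
    have : ((opPart A F).graph : Set (F × F))
        = (fun z : F × F => ((z.1 : E), (z.2 : E))) ⁻¹' (A.graph : Set (E × E)) := by
      rw [graph_opPart]; rfl
    rw [LinearPMap.IsClosed, this]
    exact hA.isClosed.preimage (by fun_prop)
  injective x y h := Subtype.ext (hA.injective (congrArg Subtype.val h))
  continuous x := (hA.continuous x).subtype_mk _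
  comm_generator t x y h := mem_graph_opPart.2 (hA.comm_generator t _ _ (mem_graph_opPart.1 h))
  comm_regularizer t x := Subtype.ext (hA.comm_regularizer t x)
  integral_mem x t := by
    obtain ⟨y, hy, hy'⟩ := hA.integral_mem x t
    have hyF : y ∈ F := hy.mem hF fun s => hSF s x x.2
    exact ⟨⟨y, hyF⟩, hasIntegral_coe_iff.1 hy, mem_graph_opPart.2 hy'⟩

variable [T2Space E] [BarrelledSpace ℂ E]

theorem IsSubgenerator.mem_solutionSpace_opPart (hA : IsSubgenerator A C S) {F : Submodule ℂ E}
    (hF : IsClosed (F : Set E)) {x : F} {w : ℝ≥0 → F} (hw : IsMildSolution A x fun s => (w s : E)) :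
    x ∈ solutionSpace (opPart A F) := by
  refine ⟨w, (isMildSolution_coe_iff hF).1 hw, fun w' hw' => funext fun s => Subtype.ext ?_⟩
  exact congrFun (hA.mildSolution_unique ((isMildSolution_coe_iff hF).2 hw') hw) s

variable [CompleteSpace E]

omit [IsUniformAddGroup E] [ContinuousSMul ℂ E] [LocallyConvexSpace ℝ E] [PolynormableSpace ℂ E]
    [T2Space E] [BarrelledSpace ℂ E] [CompleteSpace E] in
theorem isWeakMild_exp_smul {s : ℝ} {x : E} (hx : (x, (Complex.I * (s : ℂ)) • x) ∈ A.graph) :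
    IsWeakMild A fun t => Complex.exp (Complex.I * t * s) • x := by
  intro φ ψ h a b
  have h1 := h _ _ hx
  simp only [map_smul, map_sub, smul_eq_mul] at h1 ⊢
  rw [intervalIntegral.integral_mul_const, ← sub_mul, ← integral_exp_I_mul]
  linear_combination (∫ t in a..b, Complex.exp (Complex.I * t * s)) * h1

/-- The curve `e^{its} x` is the mild solution starting at `x`, and `C` maps it to `S t x`. -/
theorem IsSubgenerator.apply_eigenvector (hA : IsSubgenerator A C S) {s : ℝ} {x : E}
    (hx : (x, (Complex.I * (s : ℂ)) • x) ∈ A.graph) (t : ℝ≥0) :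
    S t x = Complex.exp (Complex.I * (t : ℝ) * s) • C x := by
  have h1 := (isWeakMild_exp_smul hx).isMildSolution hA.isClosed (by fun_prop)
  have h2 := hA.regularizer_mildSolution h1 t
  simpa using h2.symm

theorem IsSubgenerator.mem_of_mem_closure_fieldSpan (hA : IsSubgenerator A C S) {Γ : Type*}
    {I : Γ → Set ℝ} {f : Γ → ℝ → E}
    (hAf : ∀ j, ∀ t ∈ I j, (f j t, (Complex.I * (t : ℂ)) • f j t) ∈ A.graph) {F : Submodule ℂ E}
    (hF : F = (fieldSpan I f).topologicalClosure) (hCF : ∀ x ∈ F, C x ∈ F) (t : ℝ≥0) :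
    ∀ x ∈ F, S t x ∈ F := by
  have hFc : IsClosed (F : Set E) := by rw [hF]; exact Submodule.isClosed_topologicalClosure _
  have hle : fieldSpan I f ≤ F := by rw [hF]; exact Submodule.le_topologicalClosure _
  suffices h : (fieldSpan I f).topologicalClosure ≤ F.comap (S t).toLinearMap from
    fun x hx => h (hF ▸ hx)
  refine Submodule.topologicalClosure_minimal _ (Submodule.span_le.2 ?_)
    (hFc.preimage (S t).continuous)
  rintro _ ⟨j, s, hs, rfl⟩
  change S t (f j s) ∈ F
  rw [hA.apply_eigenvector (hAf j s hs)]
  exact F.smul_mem _ (hCF _ (hle (Submodule.subset_span ⟨j, s, hs, rfl⟩)))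

end Parts

/-! ### The main theorem. -/

theorem theorem2p10 {E : Type*} [AddCommGroup E] [Module ℂ E] [UniformSpace E]
    [IsUniformAddGroup E] [ContinuousSMul ℂ E] [T2Space E] [CompleteSpace E]
    [TopologicalSpace.SeparableSpace E]
    (p : SeminormFamily ℂ E ℕ) (hp : WithSeminorms p)
    (A : E →ₗ.[ℂ] E) (C : E →L[ℂ] E) (S : ℝ≥0 → E →L[ℂ] E)
    (hA : IsSubgenerator A C S) (hC : DenseRange C)
    (t₀ : ℝ≥0) (ht₀ : 0 < t₀)
    {Γ : Type*} (I : Γ → Set ℝ) (f : Γ → ℝ → E)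
    (hI : ∀ j, (I j).OrdConnected) (hI' : ∀ j, (I j).Nontrivial)
    (hf : ∀ j, IsC2On (f j) (I j))
    (hAf : ∀ j, ∀ t ∈ I j, (f j t, (Complex.I * (t : ℂ)) • f j t) ∈ A.graph) :
    (Dense (fieldSpan I f : Set E) →
      FrequentlyHypercyclicSemigroup A C S ∧
      FrequentlyHypercyclicOp (regularizedOp A C S t₀)) ∧
    (∀ F : Submodule ℂ E, F = (fieldSpan I f).topologicalClosure →
      (∀ hCF : ∀ x ∈ F, C x ∈ F,
        ∃ hSF : ∀ t, ∀ x ∈ F, S t x ∈ F,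
          IsSubgenerator (opPart A F) (C.restrict hCF) (fun t => (S t).restrict (hSF t)) ∧
          FrequentlyHypercyclicSemigroup (opPart A F) (C.restrict hCF)
            (fun t => (S t).restrict (hSF t))) ∧
      FrequentlyHypercyclicFamily (fun t => graphPart (regularizedOp A C S t) F) ∧
      FrequentlyHypercyclicOp (graphPart (regularizedOp A C S t₀) F)) := by
  have : LocallyConvexSpace ℝ E := hp.toLocallyConvexSpace
  have : PolynormableSpace ℂ E := hp.toPolynormableSpace
  have := hp.firstCountableTopology
  have : (uniformity E).IsCountablyGenerated := IsUniformAddGroup.uniformity_countably_generated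
  have : BarrelledSpace ℂ E := inferInstance
  let G := (fieldSpan I f).topologicalClosure
  have hG : IsClosed (G : Set E) := Submodule.isClosed_topologicalClosure _
  have hd : G ≤ (IsDecayingSolution.initialValues p A G).topologicalClosure :=
    Submodule.topologicalClosure_minimal _
      (fieldSpan_le_closure_initialValues hp hG hI hI' hf (fun j t ht =>
        Submodule.le_topologicalClosure _ (Submodule.subset_span ⟨j, t, ht, rfl⟩)) hAf)
      (Submodule.isClosed_topologicalClosure _)
  obtain ⟨u, huc, huG, hu, hV⟩ := exists_frequentlyVisiting_solution hp hG hd ht₀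
  -- Translates of `u` are again solutions; by uniqueness this gives `T(t) u(c) = u(c + t)`.
  have hmild : ∀ c : ℝ≥0, IsMildSolution A (u c) fun t => u (c + t : ℝ≥0) := fun c => by
    simpa using (hu.comp_add c).isMildSolution hA.isClosed (by fun_prop)
  have horbit : ∀ c t : ℝ≥0, (u c, u (c + t : ℝ≥0)) ∈ regularizedOp A C S t := fun c t =>
    ⟨hA.mem_solutionSpace (hmild c), hA.regularizer_mildSolution (hmild c) t⟩
  refine ⟨fun hdense => ?_, ?_⟩
  · have hV' : ∀ V : Set E, IsOpen V → V.Nonempty → (V ∩ G).Nonempty := fun V hVo hne => by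
      have : G = ⊤ := (Submodule.dense_iff_topologicalClosure_eq_top).1 hdense
      simpa [this] using hne
    exact ⟨frequentlyHypercyclicFamily_of_orbit (v := fun t : ℝ≥0 => u t) horbit
        fun V hVo hne => (hV V hVo (hV' V hVo hne)).1,
      frequentlyHypercyclicOp_of_orbit (v := fun t : ℝ≥0 => u t) horbit
        fun V hVo hne => (hV V hVo (hV' V hVo hne)).2⟩
  · rintro F rfl
    let v : ℝ≥0 → G := fun t => ⟨u t, huG t⟩
    have hVG : ∀ V : Set G, IsOpen V → V.Nonempty → 0 < lowerDensityReal (v ⁻¹' V) ∧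
        0 < lowerDensityNat {n : ℕ | v (n * t₀) ∈ V} := by
      rintro _ ⟨W, hW, rfl⟩ ⟨x, hx⟩
      exact hV W hW ⟨x, hx, x.2⟩
    have hvorbit : ∀ c t, (v c, v (c + t)) ∈ graphPart (regularizedOp A C S t) G := horbit
    refine ⟨fun hCF => ⟨hA.mem_of_mem_closure_fieldSpan hAf rfl hCF, hA.restrict hG hCF _, ?_⟩,
      frequentlyHypercyclicFamily_of_orbit hvorbit fun V hVo hne => (hVG V hVo hne).1,
      frequentlyHypercyclicOp_of_orbit hvorbit fun V hVo hne => (hVG V hVo hne).2⟩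
    refine frequentlyHypercyclicFamily_of_orbit (v := v) (fun c t => ⟨?_, ?_⟩)
      fun V hVo hne => (hVG V hVo hne).1
    · exact hA.mem_solutionSpace_opPart hG (w := fun t => v (c + t)) (hmild c)
    · exact Subtype.ext (horbit c t).2
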